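/- Let $d\ge 2$ and let $V$ be a finite non-empty set of agents. A pseudorange framework in $\mathbb R^d$ is a pair $(\Gamma,p)$ of a loopless simple digraph $\Gamma=(V,E)$ (for $u\neq v$ it may contain $uv$, $vu$, both or neither) and a configuration $p=(x_v,\beta_v)_{v\in V}$, $x_v\in\mathbb R^d$, $\beta_v\in\mathbb R$; an arc $uv$ carries the constraint function $f_{P,uv}(p)=\|x_u-x_v\|+\beta_v-\beta_u$. A distance framework is a pair $(G,x)$ of a simple undirected graph $G$ on $V$ and positions $x=(x_v)_{v\in V}$; an edge $uv$ carries $f_{D,uv}(x)=\|x_u-x_v\|$. A framework is rigid if every configuration close enough to the given one at which the constraint functions of all arcs (edges) of the graph take the same values is such that the constraint functions of all pairs $uv$, $u\ne v$, take the same values. A framework is generic if the $|V|d$ coordinates of its positions are not a root of any nonzero polynomial with integer coefficients (no condition on the $\beta_v$). A graph $G$ is distance rigid in $\mathbb R^d$ if all generic distance frameworks $(G,x)$ in $\mathbb R^d$ are rigid. An undirected pseudorange graph $\tilde\Gamma$ is a loopless undirected multigraph on $V$ in which every edge has multiplicity at most $2$; it is rigid in $\mathbb R^d$ if all generic pseudorange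 frameworks $(\Gamma,p)$ in $\mathbb R^d$ with underlying undirected multigraph $\tilde\Gamma$ are rigid. Let $E_1$, $E_2$ be the sets of edges of multiplicity $1$ and $2$. A decomposition of $\tilde\Gamma$ is a pair of simple graphs $G_D=(V,E_D)$, $G_S=(V,E_S)$ with $E_D\cup E_S=E_1\cup E_2$ and $E_D\cap E_S=E_2$. Then: (1) $\tilde\Gamma$ is rigid in $\mathbb R^d$ if and only if it has a decomposition $(G_D,G_S)$ with $G_D$ distance rigid in $\mathbb R^d$ and $G_S$ connected. (2) For every digraph $\Gamma$ with underlying undirected multigraph $\tilde\Gamma$, the pseudorange rigidity matroid of $\Gamma$ is the union of its distance rigidity matroid and its cycle matroid. Here all three matroids have the arcs of $\Gamma$ as ground set. A set of arcs is independent in the pseudorange (resp. distance) rigidity matroid if its rows $\|x_u-x_v\|\,\nabla f_{P,uv}(p)$ (resp. $\|x_u-x_v\|\,\nabla f_{D,uv}(x)$) are linearly independent at a generic configuration. It is independent in the cycle matroid if, as a set of edges of the undirected multigraph, it contains no cycle (two opposite arcs form a cycle). The independent sets of the union of two matroids are the unions $I_1\cup I_2$ of an independent set of the first and one of the second. The equality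 holds for every choice of generic configurations, $p$ for the pseudorange and $x$ for the distance rigidity matroid, independently of each other. -/

import Mathlib

open scoped Topology

noncomputable section

namespace Pseudorange

/-! ### Frameworks, constraints, generic configurations, rigidity -/

/-- A distance configuration: the positions of the agents in `ℝ^d`. -/
abbrev Positions (V : Type*) (d : ℕ) : Type _ := V → EuclideanSpace ℝ (Fin d)

/-- A pseudorange configuration: the positions of the agents and their clock biases. -/
abbrev Config (V : Type*) (d : ℕ) : Type _ := Positions V d × (V → ℝ)

/-- The constraint of distance rigidity, `‖x_u - x_v‖`, for `a = (u, v)`. -/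
def distanceConstraint {V : Type*} {d : ℕ} (a : V × V) (x : Positions V d) : ℝ :=
  ‖x a.1 - x a.2‖

/-- The constraint of pseudorange rigidity, `‖x_u - x_v‖ + β_v - β_u`, for the arc `a = (u, v)`. -/
def pseudorangeConstraint {V : Type*} {d : ℕ} (a : V × V) (p : Config V d) : ℝ :=
  ‖p.1 a.1 - p.1 a.2‖ + p.2 a.2 - p.2 a.1

/-- The coordinates of the agents are not a root of any nonzero polynomial with integer
coefficients. -/
def GenericPositions {V : Type*} {d : ℕ} (x : Positions V d) : Prop :=
  AlgebraicIndependent ℤ (fun i : V × Fin d => x i.1 i.2)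

/-- Genericity of a pseudorange configuration only concerns the positions, not the biases. -/
def GenericConfig {V : Type*} {d : ℕ} (p : Config V d) : Prop :=
  GenericPositions p.1

/-- Rigidity of the framework with set of arcs `E`, constraints `f` and configuration `p`:
every configuration `q` close enough to `p` which is equivalent to `p` (same values of the
constraints on `E`) is congruent to `p` (same values of the constraints on the complete graph).
On a finite-dimensional space of configurations, closeness does not depend on the norm. -/
def IsRigidFramework {V C : Type*} [TopologicalSpace C] (f : V × V → C → ℝ)
    (E : Set (V × V)) (p : C) : Prop :=
  ∀ᶠ q in 𝓝 p, (∀ a ∈ E, f a p = f a q) → ∀ u v : V, u ≠ v → f (u, v) p = f (u, v) q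

/-- A simple graph is distance rigid in `ℝ^d` if its generic frameworks are rigid. -/
def IsDistanceRigid {V : Type*} (d : ℕ) (G : SimpleGraph V) : Prop :=
  ∀ x : Positions V d, GenericPositions x →
    IsRigidFramework distanceConstraint {a : V × V | G.Adj a.1 a.2} x

/-! ### Directed and undirected pseudorange graphs -/

/-- The set of arcs of a digraph. -/
def arcs {V : Type*} (Γ : Digraph V) : Set (V × V) := {a | Γ.Adj a.1 a.2}

/-- An undirected pseudorange graph on `V`: a loopless undirected multigraph in which every edge
appears at most twice; `mult e` is the number of times that `e` appears. -/
structure UndirectedGraph (V : Type*) where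
  mult : Sym2 V → ℕ
  mult_le_two : ∀ e, mult e ≤ 2
  mult_of_isDiag : ∀ e, e.IsDiag → mult e = 0

/-- `T` is the underlying undirected multigraph of the directed graph `Γ`. -/
def IsUnderlying {V : Type*} (Γ : Digraph V) (T : UndirectedGraph V) : Prop :=
  ∀ e : Sym2 V, T.mult e = {a ∈ arcs Γ | s(a.1, a.2) = e}.ncard

/-- An undirected pseudorange graph is rigid in `ℝ^d` if the generic pseudorange frameworks of
which it is the underlying undirected graph are rigid. -/
def IsRigid {V : Type*} (d : ℕ) (T : UndirectedGraph V) : Prop :=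
  ∀ Γ : Digraph V, IsUnderlying Γ T → ∀ p : Config V d, GenericConfig p →
    IsRigidFramework pseudorangeConstraint (arcs Γ) p

/-- `(GD, GS)` is a decomposition of `T`: with `E₁` the set of edges that appear once and `E₂` the
set of edges that appear twice, `E_D ∪ E_S = E₁ ∪ E₂` and `E_D ∩ E_S = E₂`. -/
def IsDecomposition {V : Type*} (T : UndirectedGraph V) (GD GS : SimpleGraph V) : Prop :=
  GD.edgeSet ∪ GS.edgeSet = {e | T.mult e = 1} ∪ {e | T.mult e = 2} ∧
    GD.edgeSet ∩ GS.edgeSet = {e | T.mult e = 2}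

/-! ### Rigidity matrices, given by their rows

A row of a rigidity matrix is a linear functional on velocity vectors: the derivative of the
constraint, multiplied by the distance between the two agents. -/

/-- The row of the distance rigidity matrix at `x` for the arc `a`. -/
def distanceRow {V : Type*} [Fintype V] {d : ℕ} (x : Positions V d) (a : V × V) :
    Positions V d →L[ℝ] ℝ :=
  ‖x a.1 - x a.2‖ • fderiv ℝ (distanceConstraint a) x

/-- The row of the pseudorange rigidity matrix at `p` for the arc `a`. -/
def pseudorangeRow {V : Type*} [Fintype V] {d : ℕ} (p : Config V d) (a : V × V) :
    Config V d →L[ℝ] ℝ :=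
  ‖p.1 a.1 - p.1 a.2‖ • fderiv ℝ (pseudorangeConstraint a) p

/-! ### Matroids -/

theorem exists_notMem_span {α W : Type*} [Finite α] [AddCommGroup W] [Module ℝ W] {f : α → W}
    {I J : Set α} (hJ : LinearIndepOn ℝ f J) (h : I.ncard < J.ncard) :
    ∃ e ∈ J, f e ∉ Submodule.span ℝ (f '' I) := by
  classical
  by_contra! hc
  have := Fintype.ofFinite α
  have := Fintype.ofFinite J
  have := Fintype.ofFinite I
  have hle : Submodule.span ℝ (f '' J) ≤ Submodule.span ℝ (f '' I) := by
    rw [Submodule.span_le]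
    rintro _ ⟨e, he, rfl⟩
    exact hc e he
  have : FiniteDimensional ℝ (Submodule.span ℝ (f '' I)) :=
    FiniteDimensional.span_of_finite ℝ ((Set.toFinite I).image f)
  have h1 := Submodule.finrank_mono hle
  have h2 : Module.finrank ℝ (Submodule.span ℝ (f '' J)) = J.ncard := by
    have := finrank_span_eq_card (R := ℝ) (b := fun x : J => f x) hJ
    rw [Set.image_eq_range, this, ← Nat.card_eq_fintype_card, Nat.card_coe_set_eq]
  have h3 : Module.finrank ℝ (Submodule.span ℝ (f '' I)) ≤ I.ncard := by
    have := finrank_range_le_card (R := ℝ) (fun x : I => f x)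
    rwa [Set.image_eq_range, ← Nat.card_coe_set_eq, Nat.card_eq_fintype_card]
  omega

/-- The matroid on `E` in which a set is independent if the corresponding rows are linearly
independent (as a family indexed by this set). -/
def rowMatroid {α W : Type*} [Finite α] [AddCommGroup W] [Module ℝ W] (E : Set α) (f : α → W) :
    Matroid α :=
  (IndepMatroid.ofFinite (Set.toFinite E) (fun I => I ⊆ E ∧ LinearIndepOn ℝ f I)
    ⟨Set.empty_subset _, linearIndepOn_empty ℝ f⟩
    (fun _ _ hJ hIJ => ⟨hIJ.trans hJ.1, hJ.2.mono hIJ⟩)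
    (by
      intro I J hI hJ h
      obtain ⟨e, heJ, he⟩ := exists_notMem_span hJ.2 h
      have heI : e ∉ I := fun hm => he (Submodule.subset_span (Set.mem_image_of_mem f hm))
      exact ⟨e, heJ, heI, Set.insert_subset (hJ.1 heJ) hI.1,
        (linearIndepOn_insert heI).2 ⟨hI.2, he⟩⟩)
    (fun _ hI => hI.1)).matroid

/-- The pseudorange rigidity matroid of `Γ`, computed at `p`. -/
def pseudorangeMatroid {V : Type*} [Fintype V] {d : ℕ} (Γ : Digraph V) (p : Config V d) :
    Matroid (V × V) :=
  rowMatroid (arcs Γ) (pseudorangeRow p)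

/-- The distance rigidity matroid of `Γ` viewed as an undirected multigraph, computed at `x`. -/
def distanceMatroid {V : Type*} [Fintype V] {d : ℕ} (Γ : Digraph V) (x : Positions V d) :
    Matroid (V × V) :=
  rowMatroid (arcs Γ) (distanceRow x)

/-- The simple graph in which the ends of every arc in `I` are adjacent. -/
def arcGraph {V : Type*} (I : Set (V × V)) : SimpleGraph V :=
  SimpleGraph.fromRel fun u v => (u, v) ∈ I

/-- The arcs in `I`, viewed as edges of an undirected multigraph, form no cycle: no loop, no
pair of opposite arcs (a cycle of length two), and no longer cycle. -/
def IsForest {V : Type*} (I : Set (V × V)) : Prop :=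
  (∀ u v : V, (u, v) ∈ I → (v, u) ∉ I) ∧ (arcGraph I).IsAcyclic

theorem IsForest.subset {V : Type*} {I J : Set (V × V)} (hJ : IsForest J) (h : I ⊆ J) :
    IsForest I := by
  refine ⟨fun u v hu hv => hJ.1 u v (h hu) (h hv), hJ.2.anti ?_⟩
  intro u v huv
  simp only [arcGraph, SimpleGraph.fromRel_adj] at huv ⊢
  exact ⟨huv.1, huv.2.imp (fun x => h x) (fun x => h x)⟩

theorem IsForest.not_reachable {V : Type*} {I : Set (V × V)} (hI : IsForest I) {a : V × V}
    (ha : a ∈ I) : ¬ (arcGraph (I \ {a})).Reachable a.1 a.2 := by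
  obtain ⟨u, v⟩ := a
  have hvu := hI.1 u v ha
  have huv : u ≠ v := by rintro rfl; exact hvu ha
  have hadj : (arcGraph I).Adj u v := by
    simp only [arcGraph, SimpleGraph.fromRel_adj]
    exact ⟨huv, Or.inl ha⟩
  have hb := SimpleGraph.isAcyclic_iff_forall_adj_isBridge.1 hI.2 hadj
  rw [SimpleGraph.isBridge_iff] at hb
  refine fun hr => hb (hr.mono ?_)
  intro x y hxy
  simp only [arcGraph, SimpleGraph.fromRel_adj, SimpleGraph.deleteEdges_adj, Set.mem_sdiff,
    Set.mem_singleton_iff, Prod.mk.injEq, Sym2.eq_iff] at hxy ⊢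
  refine ⟨⟨hxy.1, hxy.2.imp And.left And.left⟩, ?_⟩
  rintro (⟨rfl, rfl⟩ | ⟨rfl, rfl⟩)
  · rcases hxy.2 with h | h
    · exact h.2 ⟨rfl, rfl⟩
    · exact hvu h.1
  · rcases hxy.2 with h | h
    · exact hvu h.1
    · exact h.2 ⟨rfl, rfl⟩

open scoped Classical in
theorem IsForest.linearIndepOn {V : Type*} [Fintype V] {I : Set (V × V)} (hI : IsForest I) :
    LinearIndepOn ℝ (fun a : V × V => (Pi.single a.1 1 - Pi.single a.2 1 : V → ℝ)) I := by
  rw [LinearIndepOn, Fintype.linearIndependent_iff]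
  intro c hc a
  have hna := hI.not_reachable a.2
  let S : V → ℝ := fun w => if (arcGraph (I \ {a.1})).Reachable a.1.1 w then 1 else 0
  let φ : (V → ℝ) →ₗ[ℝ] ℝ := Fintype.linearCombination ℝ S
  have hφ : ∀ w, φ (Pi.single w 1) = S w := by
    intro w
    simp [φ, Fintype.linearCombination_apply, Pi.single_apply]
  have h0 := congrArg φ hc
  rw [map_sum, map_zero, Finset.sum_eq_single a] at h0
  · simpa [hφ, S, hna] using h0
  · intro b _ hba
    have hb : S b.1.1 = S b.1.2 := by
      by_cases hl : b.1.1 = b.1.2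
      · rw [hl]
      have hadj : (arcGraph (I \ {a.1})).Adj b.1.1 b.1.2 := by
        simp only [arcGraph, SimpleGraph.fromRel_adj]
        exact ⟨hl, Or.inl ⟨b.2, fun h => hba (Subtype.ext h)⟩⟩
      have : (arcGraph (I \ {a.1})).Reachable a.1.1 b.1.1 ↔
          (arcGraph (I \ {a.1})).Reachable a.1.1 b.1.2 :=
        ⟨fun h => h.trans hadj.reachable, fun h => h.trans hadj.symm.reachable⟩
      simp only [S, this]
    simp [hφ, hb]
  · intro h
    exact absurd (Finset.mem_univ a) h

open scoped Classical in
theorem single_sub_single_mem_span {V : Type*} {I : Set (V × V)} {u v : V}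
    (h : (arcGraph I).Reachable u v) : (Pi.single u 1 - Pi.single v 1 : V → ℝ) ∈
      Submodule.span ℝ ((fun a : V × V => (Pi.single a.1 1 - Pi.single a.2 1 : V → ℝ)) '' I) := by
  obtain ⟨w⟩ := h
  induction w with
  | nil => simp
  | @cons x y z hxy _ ih =>
    simp only [arcGraph, SimpleGraph.fromRel_adj] at hxy
    have hs : (Pi.single x 1 - Pi.single y 1 : V → ℝ) ∈ Submodule.span ℝ
        ((fun a : V × V => (Pi.single a.1 1 - Pi.single a.2 1 : V → ℝ)) '' I) := by
      rcases hxy.2 with h | h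
      · exact Submodule.subset_span ⟨_, h, rfl⟩
      · rw [← neg_sub]
        exact Submodule.neg_mem _ (Submodule.subset_span ⟨_, h, rfl⟩)
    have := Submodule.add_mem _ hs ih
    simpa using this

theorem IsForest.insert {V : Type*} {I : Set (V × V)} (hI : IsForest I) {a : V × V}
    (ha : ¬ (arcGraph I).Reachable a.1 a.2) : IsForest (insert a I) := by
  obtain ⟨u, v⟩ := a
  have huv : u ≠ v := by
    rintro rfl
    exact ha (SimpleGraph.Reachable.refl _)
  have hvu : (v, u) ∉ I := by
    intro h
    refine ha (SimpleGraph.Adj.reachable ?_)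
    simp only [arcGraph, SimpleGraph.fromRel_adj]
    exact ⟨huv, Or.inr h⟩
  refine ⟨?_, (hI.2.sup_edge_of_not_reachable ha).anti ?_⟩
  · intro x y hx hy
    simp only [Set.mem_insert_iff, Prod.mk.injEq] at hx hy
    have := hI.1 x y
    grind
  · intro x y hxy
    simp only [arcGraph, SimpleGraph.fromRel_adj, Set.mem_insert_iff, Prod.mk.injEq,
      SimpleGraph.sup_adj, SimpleGraph.edge_adj] at hxy ⊢
    grind

/-- The cycle matroid of `Γ` viewed as an undirected multigraph: a set of arcs is independent if
it contains no cycle. -/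
def cycleMatroid {V : Type*} [Fintype V] (Γ : Digraph V) : Matroid (V × V) :=
  (IndepMatroid.ofFinite (Set.toFinite (arcs Γ)) (fun I => I ⊆ arcs Γ ∧ IsForest I)
    ⟨Set.empty_subset _, fun _ _ h => absurd h (Set.notMem_empty _), by
      have : arcGraph (∅ : Set (V × V)) = ⊥ := by
        ext u v
        simp [arcGraph]
      rw [this]
      exact SimpleGraph.isAcyclic_bot⟩
    (fun _ _ hJ hIJ => ⟨hIJ.trans hJ.1, hJ.2.subset hIJ⟩)
    (by
      classical
      intro I J hI hJ h
      obtain ⟨e, heJ, he⟩ := exists_notMem_span hJ.2.linearIndepOn h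
      have heI : e ∉ I := fun hm => he (Submodule.subset_span (Set.mem_image_of_mem _ hm))
      exact ⟨e, heJ, heI, Set.insert_subset (hJ.1 heJ) hI.1,
        hI.2.insert fun hr => he (single_sub_single_mem_span hr)⟩)
    (fun _ hI => hI.1)).matroid

/-- `M` is the union of the matroids `M₁` and `M₂`: its independent sets are the unions of an
independent set of `M₁` and an independent set of `M₂`. -/
def IsMatroidUnion {α : Type*} (M M₁ M₂ : Matroid α) : Prop :=
  M.E = M₁.E ∪ M₂.E ∧
    ∀ I : Set α, M.Indep I ↔ ∃ I₁ I₂ : Set α, M₁.Indep I₁ ∧ M₂.Indep I₂ ∧ I = I₁ ∪ I₂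

end Pseudorange

end

/-! In coordinates, the row of an arc `a` is a sum `v a + w a`. Here `v a` is its distance row and
`w a` is minus the length of `a` times its incidence row; they live in complementary subspaces.
Forests are the independent sets of incidence rows.

In an independent family of sums, one summand of each can be kept without losing independence
(`exists_linearIndepOn_ite`). This splits an independent set of pseudorange rows into a
distance-independent set and a forest.

Conversely, choosing `v` on the first set and `w` on the rest of the second gives an independent
family. Each chosen summand can be exchanged for `v a + w a` or `v a - w a`, with a sign depending
only on the undirected edge (`exists_signs`). The result is the pseudorange matrix with some lengths
negated. At generic positions these signs do not affect independence: each length is a square root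
outside the field generated by the coordinates and the other lengths (`edgeDist_notMem`), so
changing its sign preserves algebraic relations (`aeval_signs_eq_zero`), in particular the vanishing
of a Gram determinant. For `d ≥ 2` the required independence of square roots holds because no
nonempty product of squared lengths of distinct edges is a square (`sq_ne_prod_edgePoly`). This
proves the matroid union.

For rigidity, generic positions make the independent sets as large as possible, so a generic
framework is rigid exactly when its rows span all rows (`isRigidFramework_iff`). The decomposition
theorem follows by counting bases: the rank of the complete digraph is the sum of its distance and
incidence ranks. -/

namespace Pseudorange

/-! ### Linear algebra: families of sums -/

section LinearAlgebra

variable {α β W : Type*} [AddCommGroup W] [Module ℝ W]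

/-- A vector of an independent family may be replaced by any vector outside the span of the other
ones. -/
theorem linearIndepOn_of_notMem_span {f g : α → W} {I : Set α} {a : α} (hf : LinearIndepOn ℝ f I)
    (ha : a ∈ I) (hfg : ∀ b, b ≠ a → g b = f b)
    (h : g a ∉ Submodule.span ℝ (f '' (I \ {a}))) : LinearIndepOn ℝ g I := by
  have himg : g '' (I \ {a}) = f '' (I \ {a}) :=
    Set.image_congr fun b hb => hfg b hb.2
  rw [← Set.insert_sdiff_self_of_mem ha, linearIndepOn_insert (by simp), himg]
  exact ⟨(hf.mono Set.sdiff_subset).congr fun b hb => (hfg b hb.2).symm, h⟩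

theorem notMem_span_sdiff {f : α → W} {I : Set α} {a : α} (hf : LinearIndepOn ℝ f I)
    (ha : a ∈ I) : f a ∉ Submodule.span ℝ (f '' (I \ {a})) := by
  rw [← Set.insert_sdiff_self_of_mem ha, linearIndepOn_insert (by simp)] at hf
  exact hf.2

/-- In an independent family of sums, one summand of every sum may be chosen such that the chosen
summands are independent. -/
theorem exists_linearIndepOn_ite [Finite α] {v w : α → W} {I : Set α}
    (h : LinearIndepOn ℝ (fun a => v a + w a) I) :
    ∃ u : α → W, (∀ a, u a = v a ∨ u a = w a) ∧ LinearIndepOn ℝ u I := by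
  classical
  have := Fintype.ofFinite α
  suffices H : ∀ s : Finset α, ∃ u : α → W, (∀ a ∈ s, u a = v a ∨ u a = w a) ∧
      (∀ a ∉ s, u a = v a + w a) ∧ LinearIndepOn ℝ u I by
    obtain ⟨u, hu, -, hI⟩ := H Finset.univ
    exact ⟨u, fun a => hu a (Finset.mem_univ a), hI⟩
  intro s
  induction s using Finset.induction_on with
  | empty => exact ⟨fun a => v a + w a, by simp, by simp, h⟩
  | insert a s has ih =>
    obtain ⟨u, hu, hu', hI⟩ := ih
    obtain ⟨z, hz, hzI⟩ : ∃ z, (z = v a ∨ z = w a) ∧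
        LinearIndepOn ℝ (Function.update u a z) I := by
      by_cases ha : a ∈ I
      · have hn := notMem_span_sdiff hI ha
        rw [hu' a has] at hn
        -- If both summands were in the span of the other vectors, so would be their sum.
        have : ∃ z, (z = v a ∨ z = w a) ∧ z ∉ Submodule.span ℝ (u '' (I \ {a})) := by
          by_contra! hc
          exact hn (Submodule.add_mem _ (hc _ (Or.inl rfl)) (hc _ (Or.inr rfl)))
        obtain ⟨z, hz, hzn⟩ := this
        exact ⟨z, hz, linearIndepOn_of_notMem_span hI ha
          (fun b hb => Function.update_of_ne hb _ _) (by simpa using hzn)⟩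
      · refine ⟨v a, Or.inl rfl, hI.congr fun b hb => ?_⟩
        rw [Function.update_of_ne]
        rintro rfl
        exact ha hb
    refine ⟨Function.update u a z, ?_, ?_, hzI⟩
    · intro b hb
      by_cases hba : b = a
      · subst hba
        simpa using hz
      · rw [Function.update_of_ne hba]
        exact hu b ((Finset.mem_insert.1 hb).resolve_left hba)
    · intro b hb
      rw [Finset.mem_insert, not_or] at hb
      rw [Function.update_of_ne hb.1]
      exact hu' b hb.2

/-- Conversely, an independent choice of summands yields signs for which the signed sums are
independent. The signs may be taken constant on the fibres of `κ`, if on such a fibre the first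
summands agree and the second ones agree up to sign. -/
theorem exists_signs [Finite α] {v w u : α → W} {κ : α → β} {I : Set α}
    (hu : ∀ a ∈ I, u a = v a ∨ u a = w a)
    (hκ : ∀ a b, a ≠ b → κ a = κ b → v a = v b ∧ w a = - w b) (hI : LinearIndepOn ℝ u I) :
    ∃ s : β → ℝ, (∀ b, s b = 1 ∨ s b = -1) ∧ LinearIndepOn ℝ (fun a => v a + s (κ a) • w a) I := by
  classical
  have := Fintype.ofFinite α
  -- Signed sums replace the vectors `u a` one index at a time: `t` holds the treated indices and
  -- `f` is the current mixed family.
  suffices H : ∀ t : Finset α, ∃ (s : β → ℝ) (f : α → W), (∀ b, s b = 1 ∨ s b = -1) ∧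
      (∀ a ∈ t, a ∈ I → f a = v a + s (κ a) • w a) ∧ (∀ a ∉ t, f a = u a) ∧
      LinearIndepOn ℝ f I by
    obtain ⟨s, f, hs, hf, -, hfI⟩ := H Finset.univ
    exact ⟨s, hs, hfI.congr fun a ha => hf a (Finset.mem_univ a) ha⟩
  intro t
  induction t using Finset.induction_on with
  | empty => exact ⟨fun _ => 1, u, by simp, by simp, by simp, hI⟩
  | insert a t hat ih =>
    obtain ⟨s, f, hs, hft, hfn, hfI⟩ := ih
    by_cases ha : a ∈ I
    swap
    · refine ⟨s, Function.update f a (u a), hs, ?_, ?_, hfI.congr fun b hb => ?_⟩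
      · intro b hb hbI
        have hba : b ≠ a := by rintro rfl; exact ha hbI
        rw [Function.update_of_ne hba]
        exact hft b ((Finset.mem_insert.1 hb).resolve_left hba) hbI
      · intro b hb
        rw [Finset.mem_insert, not_or] at hb
        rw [Function.update_of_ne hb.1]
        exact hfn b hb.2
      · rw [Function.update_of_ne]
        rintro rfl
        exact ha hb
    have hn := notMem_span_sdiff hfI ha
    rw [hfn a hat] at hn
    set S := Submodule.span ℝ (f '' (I \ {a})) with hS
    obtain ⟨s', hs', hst, hns⟩ : ∃ s' : β → ℝ, (∀ b, s' b = 1 ∨ s' b = -1) ∧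
        (∀ b ∈ t, b ∈ I → s' (κ b) = s (κ b)) ∧ v a + s' (κ a) • w a ∉ S := by
      -- A treated index `b` on the same fibre has already fixed the sign, and its signed sum is in
      -- `S`. By `hκ` the signed sums at `a` and `b` together span both `v a` and `w a`, so they
      -- cannot both be in `S`.
      by_cases hex : ∃ b ∈ t, b ∈ I ∧ κ a = κ b
      · obtain ⟨b, hbt, hbI, hab⟩ := hex
        have hne : a ≠ b := by rintro rfl; exact hat hbt
        obtain ⟨hv, hw⟩ := hκ a b hne hab
        have hbS : v b + s (κ b) • w b ∈ S := by
          rw [← hft b hbt hbI]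
          exact Submodule.subset_span ⟨b, ⟨hbI, hne.symm⟩, rfl⟩
        refine ⟨s, hs, fun _ _ _ => rfl, fun hc => hn ?_⟩
        rw [hab, hv, hw] at hc
        rcases hu a ha with h | h
        · have : u a = (1 / 2 : ℝ) • ((v b + s (κ b) • -w b) + (v b + s (κ b) • w b)) := by
            rw [h, hv]; module
          rw [this]
          exact S.smul_mem _ (S.add_mem hc hbS)
        · have hss : s (κ b) * s (κ b) = 1 := by rcases hs (κ b) with h | h <;> rw [h] <;> norm_num
          have : u a = (s (κ b) / 2) • ((v b + s (κ b) • -w b) - (v b + s (κ b) • w b)) := by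
            rw [h, hw]
            have : (s (κ b) / 2) • ((v b + s (κ b) • -w b) - (v b + s (κ b) • w b)) =
              - (s (κ b) * s (κ b)) • w b := by module
            rw [this, hss]; module
          rw [this]
          exact S.smul_mem _ (S.sub_mem hc hbS)
      · push Not at hex
        -- Here the sign is free. If both signs failed, half the sum and half the difference would
        -- put `v a` and `w a` in `S`.
        have key : v a + (1 : ℝ) • w a ∉ S ∨ v a + (-1 : ℝ) • w a ∉ S := by
          by_contra! hc
          rcases hu a ha with h | h
          · have : u a = (1 / 2 : ℝ) • ((v a + (1 : ℝ) • w a) + (v a + (-1 : ℝ) • w a)) := by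
              rw [h]; module
            exact hn (this ▸ S.smul_mem _ (S.add_mem hc.1 hc.2))
          · have : u a = (1 / 2 : ℝ) • ((v a + (1 : ℝ) • w a) - (v a + (-1 : ℝ) • w a)) := by
              rw [h]; module
            exact hn (this ▸ S.smul_mem _ (S.sub_mem hc.1 hc.2))
        obtain ⟨ε, hε, hεS⟩ : ∃ ε : ℝ, (ε = 1 ∨ ε = -1) ∧ v a + ε • w a ∉ S := by
          rcases key with h | h
          · exact ⟨1, Or.inl rfl, h⟩
          · exact ⟨-1, Or.inr rfl, h⟩
        refine ⟨Function.update s (κ a) ε, fun b => ?_, fun b hb hbI => ?_, by simpa using hεS⟩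
        · by_cases hb : b = κ a
          · subst hb; simpa using hε
          · rw [Function.update_of_ne hb]; exact hs b
        · rw [Function.update_of_ne]
          exact fun h => hex b hb hbI h.symm
    refine ⟨s', Function.update f a (v a + s' (κ a) • w a), hs', ?_, ?_,
      linearIndepOn_of_notMem_span hfI ha (fun b hb => Function.update_of_ne hb _ _)
        (by simpa using hns)⟩
    · intro b hb hbI
      by_cases hba : b = a
      · subst hba; simp
      · have hbt := (Finset.mem_insert.1 hb).resolve_left hba
        rw [Function.update_of_ne hba, hst b hbt hbI]
        exact hft b hbt hbI
    · intro b hb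
      rw [Finset.mem_insert, not_or] at hb
      rw [Function.update_of_ne hb.1]
      exact hfn b hb.2

/-- Size comparison of independent and spanning subfamilies. -/
theorem ncard_le_of_forall_mem_span [Finite α] {f : α → W} {I J : Set α}
    (hJ : LinearIndepOn ℝ f J) (h : ∀ e ∈ J, f e ∈ Submodule.span ℝ (f '' I)) :
    J.ncard ≤ I.ncard := by
  by_contra! hlt
  obtain ⟨e, he, hn⟩ := exists_notMem_span hJ hlt
  exact hn (h e he)

end LinearAlgebra

/-! ### Gram determinants of families of polynomial vectors -/

section Gram

open MvPolynomial

variable {α ι σ : Type*} [Fintype ι]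

/-- Over `ℝ` the matrices `M * Mᵀ` and `M` have the same rank, so a single polynomial in the entries
detects independence of the rows, even if `M` is not square. -/
theorem det_mul_transpose_ne_zero_iff {m : Type*} [Fintype m] [DecidableEq m]
    (M : Matrix m ι ℝ) : (M * M.transpose).det ≠ 0 ↔ LinearIndependent ℝ M.row := by
  rw [← isUnit_iff_ne_zero, ← Matrix.isUnit_iff_isUnit_det]
  constructor
  · intro h
    have h1 := Matrix.rank_of_isUnit _ h
    rw [Matrix.rank_self_mul_transpose] at h1
    rw [linearIndependent_iff_card_eq_finrank_span, ← h1, M.rank_eq_finrank_span_row]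
    rfl
  · intro h
    have h1 := h.rank_matrix
    rw [← Matrix.rank_self_mul_transpose] at h1
    rw [← Matrix.linearIndependent_rows_iff_isUnit, linearIndependent_iff_card_eq_finrank_span,
      ← h1, Matrix.rank_eq_finrank_span_row]
    rfl

open scoped Classical in
/-- The Gram determinant of a finite family of vectors with polynomial entries. -/
noncomputable def gramDet [Finite α] (F : α → ι → MvPolynomial σ ℤ) (I : Set α) :
    MvPolynomial σ ℤ :=
  letI := Fintype.ofFinite I
  ((Matrix.of fun a : I => F a) * (Matrix.of fun a : I => F a).transpose).det

theorem aeval_gramDet_ne_zero_iff [Finite α] (F : α → ι → MvPolynomial σ ℤ) (I : Set α)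
    (x : σ → ℝ) : aeval x (gramDet F I) ≠ 0 ↔ LinearIndepOn ℝ (fun a i => aeval x (F a i)) I := by
  classical
  let := Fintype.ofFinite I
  have : aeval x (gramDet F I) =
      ((Matrix.of fun (a : I) i => aeval x (F a i)) *
        (Matrix.of fun (a : I) i => aeval x (F a i)).transpose).det := by
    rw [gramDet, AlgHom.map_det]
    congr 1
    ext a b
    simp [Matrix.mul_apply]
  rw [this, det_mul_transpose_ne_zero_iff]
  rfl

/-- Independence at some point implies independence at every generic point. -/
theorem linearIndepOn_aeval_of_algebraicIndependent [Finite α] (F : α → ι → MvPolynomial σ ℤ)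
    {I : Set α} {x y : σ → ℝ} (hx : AlgebraicIndependent ℤ x)
    (h : LinearIndepOn ℝ (fun a i => aeval y (F a i)) I) :
    LinearIndepOn ℝ (fun a i => aeval x (F a i)) I := by
  rw [← aeval_gramDet_ne_zero_iff] at h ⊢
  intro h0
  rw [(map_eq_zero_iff _ hx)] at h0
  rw [h0] at h
  simp at h

end Gram

/-! ### Square roots over a field -/

section SquareRoots

variable {Ω : Type*} [Field Ω]

/-- The elements `a + b * y` already form a field: `y ^ 2 ∈ M` takes care of products, and the
conjugate `a - b * y` of inverses. -/
theorem exists_add_mul_of_mem_closure_insert {M : Subfield Ω} {y z : Ω}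
    (hy : y ^ 2 ∈ M) (hz : z ∈ Subfield.closure (insert y (M : Set Ω))) :
    ∃ a ∈ M, ∃ b ∈ M, z = a + b * y := by
  induction hz using Subfield.closure_induction with
  | mem x hx =>
    rcases hx with rfl | hx
    · exact ⟨0, M.zero_mem, 1, M.one_mem, by ring⟩
    · exact ⟨x, hx, 0, M.zero_mem, by ring⟩
  | one => exact ⟨1, M.one_mem, 0, M.zero_mem, by ring⟩
  | add _ _ _ _ h1 h2 =>
    obtain ⟨a, ha, b, hb, rfl⟩ := h1
    obtain ⟨c, hc, d, hd, rfl⟩ := h2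
    exact ⟨a + c, M.add_mem ha hc, b + d, M.add_mem hb hd, by ring⟩
  | neg _ _ h =>
    obtain ⟨a, ha, b, hb, rfl⟩ := h
    exact ⟨-a, M.neg_mem ha, -b, M.neg_mem hb, by ring⟩
  | mul _ _ _ _ h1 h2 =>
    obtain ⟨a, ha, b, hb, rfl⟩ := h1
    obtain ⟨c, hc, d, hd, rfl⟩ := h2
    exact ⟨a * c + b * d * y ^ 2, M.add_mem (M.mul_mem ha hc) (M.mul_mem (M.mul_mem hb hd) hy),
      a * d + b * c, M.add_mem (M.mul_mem ha hd) (M.mul_mem hb hc), by ring⟩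
  | inv _ _ h =>
    obtain ⟨a, ha, b, hb, rfl⟩ := h
    by_cases h0 : a - b * y = 0
    · refine ⟨(a + a)⁻¹, M.inv_mem (M.add_mem ha ha), 0, M.zero_mem, ?_⟩
      rw [← sub_eq_zero.1 h0]
      ring
    by_cases h1 : a + b * y = 0
    · exact ⟨0, M.zero_mem, 0, M.zero_mem, by simp [h1]⟩
    have hN : (a ^ 2 - b ^ 2 * y ^ 2)⁻¹ ∈ M :=
      M.inv_mem (M.sub_mem (M.pow_mem ha 2) (M.mul_mem (M.pow_mem hb 2) hy))
    have hN0 : a ^ 2 - b ^ 2 * y ^ 2 = (a + b * y) * (a - b * y) := by ring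
    refine ⟨a * (a ^ 2 - b ^ 2 * y ^ 2)⁻¹, M.mul_mem ha hN, -b * (a ^ 2 - b ^ 2 * y ^ 2)⁻¹,
      M.mul_mem (M.neg_mem hb) hN, ?_⟩
    rw [hN0]
    field_simp
    ring

/-- If no product of `y` with a product of some of the square roots `ρ i` lies in `K`, and the
nonempty products of the `ρ i` do not either, then `y` is not in the field that they generate. -/
theorem notMem_closure_union_image [NeZero (2 : Ω)] {ι : Type*} [DecidableEq ι] (K : Subfield Ω)
    (ρ : ι → Ω) (S : Finset ι) (hρ : ∀ i ∈ S, ρ i ^ 2 ∈ K)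
    (hS : ∀ T ⊆ S, T.Nonempty → ∏ i ∈ T, ρ i ∉ K) (y : Ω) (hy : y ^ 2 ∈ K)
    (hyS : ∀ T ⊆ S, y * ∏ i ∈ T, ρ i ∉ K) :
    y ∉ Subfield.closure ((K : Set Ω) ∪ ρ '' S) := by
  induction S using Finset.induction_on generalizing y with
  | empty => simpa using hyS ∅ le_rfl
  | insert e S he ih =>
    have hρ' : ∀ i ∈ S, ρ i ^ 2 ∈ K := fun i hi => hρ i (Finset.mem_insert_of_mem hi)
    have hS' : ∀ T ⊆ S, T.Nonempty → ∏ i ∈ T, ρ i ∉ K := fun T hT =>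
      hS T (hT.trans (Finset.subset_insert _ _))
    have ih := ih hρ' hS'
    set M := Subfield.closure ((K : Set Ω) ∪ ρ '' S) with hM
    have hKM : K ≤ M := fun k hk => Subfield.subset_closure (Or.inl hk)
    have hsub : Subfield.closure ((K : Set Ω) ∪ ρ '' (insert e S : Finset ι)) ≤
        Subfield.closure (insert (ρ e) (M : Set Ω)) := by
      rw [Subfield.closure_le]
      rintro _ (h | ⟨i, hi, rfl⟩)
      · exact Subfield.subset_closure (Or.inr (hKM h))
      · rcases Finset.mem_insert.1 hi with rfl | hi
        · exact Subfield.subset_closure (Or.inl rfl)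
        · exact Subfield.subset_closure (Or.inr (Subfield.subset_closure (Or.inr ⟨i, hi, rfl⟩)))
    intro hyc
    have hq : ρ e ^ 2 ∈ K := hρ e (Finset.mem_insert_self _ _)
    -- The induction hypothesis applies to `ρ e`, `y` and `y * ρ e`, since `ρ e` times a product
    -- over a subset of `S` is a product over a subset of `insert e S`.
    have heM : ρ e ∉ M := ih _ hq fun T hT => by
      rw [← Finset.prod_insert fun h => he (hT h)]
      exact hS _ (Finset.insert_subset_insert _ hT) (Finset.insert_nonempty _ _)
    have hyM : y ∉ M := ih _ hy fun T hT => hyS T (hT.trans (Finset.subset_insert _ _))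
    have hyeM : y * ρ e ∉ M := ih _ (by rw [mul_pow]; exact K.mul_mem hy hq) fun T hT => by
      rw [mul_assoc, ← Finset.prod_insert fun h => he (hT h)]
      exact hyS _ (Finset.insert_subset_insert _ hT)
    obtain ⟨a, ha, b, hb, hab⟩ := exists_add_mul_of_mem_closure_insert (hKM hq) (hsub hyc)
    by_cases hb0 : b = 0
    · rw [hb0, zero_mul, add_zero] at hab
      exact hyM (hab ▸ ha)
    by_cases ha0 : a = 0
    · apply hyeM
      rw [hab, ha0, zero_add, mul_assoc, ← sq]
      exact M.mul_mem hb (hKM hq)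
    apply heM
    have h2 : (2 : Ω) ≠ 0 := NeZero.ne 2
    -- Squaring `y = a + b * ρ e` and solving for `ρ e` in the cross term; this is where `2 ≠ 0`
    -- enters.
    have : ρ e = (y ^ 2 - a ^ 2 - b ^ 2 * ρ e ^ 2) * (2 * a * b)⁻¹ := by
      rw [hab]
      field_simp
      ring
    rw [this]
    have h2M : (2 : Ω) ∈ M := by
      rw [← one_add_one_eq_two]; exact M.add_mem M.one_mem M.one_mem
    exact M.mul_mem (M.sub_mem (M.sub_mem (hKM hy) (M.pow_mem ha 2))
      (M.mul_mem (M.pow_mem hb 2) (hKM hq))) (M.inv_mem (M.mul_mem (M.mul_mem h2M ha) hb))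

open Polynomial in
/-- Conjugation of a square root. -/
theorem aeval_neg_eq_zero {L : Subfield Ω} {y : Ω} (hy2 : y ^ 2 ∈ L) (hy : y ∉ L) {p : L[X]}
    (hp : aeval y p = 0) : aeval (-y) p = 0 := by
  set q : L[X] := X ^ 2 - C ⟨y ^ 2, hy2⟩ with hq
  have hqm : q.Monic := monic_X_pow_sub_C _ two_ne_zero
  -- The remainder modulo `X ^ 2 - y ^ 2` is linear and vanishes at `y ∉ L`, so it is zero. Hence
  -- `q` divides `p`, and `-y` is a root of `q`.
  have hdeg : (p %ₘ q).degree ≤ 1 := by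
    have h1 := degree_modByMonic_lt p hqm
    rw [hq, degree_X_pow_sub_C two_pos] at h1
    exact Order.le_of_lt_succ h1
  have hlin := eq_X_add_C_of_degree_le_one hdeg
  set b := (p %ₘ q).coeff 1
  set a := (p %ₘ q).coeff 0
  have hqy : aeval y q = 0 := by simp [hq, Algebra.algebraMap_ofSubsemiring_apply]
  have hqy' : aeval (-y) q = 0 := by simp [hq, Algebra.algebraMap_ofSubsemiring_apply]
  have hdiv := modByMonic_add_div p q
  have h1 : (b : Ω) * y + a = 0 := by
    rw [← hdiv, hlin] at hp
    simpa [hqy, Algebra.algebraMap_ofSubsemiring_apply] using hp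
  have hb : (b : Ω) = 0 := by
    by_contra hb
    apply hy
    have : y = -(a : Ω) * (b : Ω)⁻¹ := by
      field_simp
      linear_combination h1
    rw [this]
    exact L.mul_mem (L.neg_mem a.2) (L.inv_mem b.2)
  have ha : (a : Ω) = 0 := by simpa [hb] using h1
  rw [← hdiv, hlin]
  simp [hqy', Algebra.algebraMap_ofSubsemiring_apply, ha, hb]

open MvPolynomial in
-- With the other coordinates frozen in `L`, `P` becomes a polynomial in one variable over `L`, to
-- which conjugation of the root `a i` applies.
theorem aeval_update_neg_eq_zero {σ : Type*} [DecidableEq σ] {L : Subfield Ω} {a : σ → Ω} {i : σ}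
    (h : ∀ j, j ≠ i → a j ∈ L) (hi : a i ∉ L) (hi2 : a i ^ 2 ∈ L) {P : MvPolynomial σ ℤ}
    (hP : aeval a P = 0) : aeval (Function.update a i (-a i)) P = 0 := by
  let g : σ → Polynomial L := fun j =>
    if hj : j = i then Polynomial.X else Polynomial.C ⟨a j, h j hj⟩
  have key : ∀ y : Ω, Polynomial.aeval y (aeval g P) = aeval (Function.update a i y) P := by
    intro y
    have : ((Polynomial.aeval y).restrictScalars ℤ : Polynomial L →ₐ[ℤ] Ω).comp (aeval g) =
        aeval (Function.update a i y) := by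
      ext j
      by_cases hj : j = i
      · subst hj; simp [g]
      · simp [g, hj, Algebra.algebraMap_ofSubsemiring_apply]
    exact DFunLike.congr_fun this P
  rw [← key]
  apply aeval_neg_eq_zero hi2 hi
  rw [key, Function.update_eq_self]
  exact hP

end SquareRoots

/-- Generic positions exist. -/
theorem exists_genericPositions (V : Type*) [Finite V] (d : ℕ) :
    ∃ x : Positions V d, GenericPositions x := by
  obtain ⟨s, hs⟩ := exists_isTranscendenceBasis ℤ ℝ
  -- Otherwise `ℝ` would be algebraic over a countable ring, hence countable.
  have hinf : Infinite s := by
    by_contra hfin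
    rw [not_infinite_iff_finite] at hfin
    have hc : Countable (Algebra.adjoin ℤ (Set.range ((↑) : s → ℝ))) := by
      rw [Algebra.adjoin_range_eq_range_aeval]
      have : Countable (MvPolynomial s ℤ) :=
        Cardinal.mk_le_aleph0_iff.1 (MvPolynomial.cardinalMk_le_max.trans (by simp))
      exact (AlgHom.rangeRestrict_surjective _).countable
    have := hs.isAlgebraic
    have h1 := Algebra.IsAlgebraic.cardinalMk_le_max
      (Algebra.adjoin ℤ (Set.range ((↑) : s → ℝ))) ℝ
    rw [Cardinal.mk_real] at h1
    refine absurd (h1.trans (max_le Cardinal.mk_le_aleph0 le_rfl)) ?_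
    exact not_le_of_gt Cardinal.aleph0_lt_continuum
  obtain ⟨n, ⟨e⟩⟩ := Finite.exists_equiv_fin (V × Fin d)
  let f : V × Fin d → s := fun i => Infinite.natEmbedding s (e i)
  have hf : Function.Injective f := fun i j hij =>
    e.injective (Fin.ext ((Infinite.natEmbedding s).injective hij))
  refine ⟨fun v => WithLp.toLp 2 fun k => (f (v, k) : ℝ), ?_⟩
  exact hs.1.comp f hf

/-! ### The distances of a generic configuration -/

section Distances

open MvPolynomial

variable {V : Type*} {d : ℕ}

/-- The coordinates of the agents, as a function on `V × Fin d`. -/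
def coords (x : Positions V d) (i : V × Fin d) : ℝ := x i.1 i.2

/-- The distance between the ends of an edge. -/
noncomputable def edgeDist (x : Positions V d) : Sym2 V → ℝ :=
  Sym2.lift ⟨fun u v => ‖x u - x v‖, fun _ _ => norm_sub_rev _ _⟩

/-- The squared distance between the ends of an edge, as a polynomial in the coordinates. -/
noncomputable def edgePoly (V : Type*) (d : ℕ) : Sym2 V → MvPolynomial (V × Fin d) ℤ :=
  Sym2.lift ⟨fun u v => ∑ k, (X (u, k) - X (v, k)) ^ 2, fun _ _ =>
    Finset.sum_congr rfl fun _ _ => by ring⟩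

@[simp]
theorem edgeDist_mk (x : Positions V d) (u v : V) : edgeDist x s(u, v) = ‖x u - x v‖ := rfl

theorem edgePoly_mk (u v : V) :
    edgePoly V d s(u, v) = ∑ k, (X (u, k) - X (v, k)) ^ 2 := rfl

theorem aeval_edgePoly (x : Positions V d) (e : Sym2 V) :
    aeval (coords x) (edgePoly V d e) = edgeDist x e ^ 2 := by
  induction e using Sym2.ind with
  | _ u v => simp [edgePoly_mk, EuclideanSpace.norm_sq_eq, coords]

theorem edgeDist_of_isDiag (x : Positions V d) {e : Sym2 V} (he : e.IsDiag) :
    edgeDist x e = 0 := by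
  induction e using Sym2.ind with
  | _ u v =>
    rw [Sym2.mk_isDiag_iff] at he
    simp [he]

theorem GenericPositions.injective {x : Positions V d} (hx : GenericPositions x) (hd : 0 < d) :
    Function.Injective x := by
  intro u v huv
  have := AlgebraicIndependent.injective hx (a₁ := (u, ⟨0, hd⟩)) (a₂ := (v, ⟨0, hd⟩))
    (by simp [huv])
  exact congrArg Prod.fst this

/-- A nonempty product of squared distances is not the square of a polynomial. This uses that the
dimension is at least two. -/
theorem sq_ne_prod_edgePoly [Finite V] (hd : 2 ≤ d) {T : Finset (Sym2 V)} (hT : T.Nonempty)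
    (hdiag : ∀ e ∈ T, ¬ e.IsDiag) (k : MvPolynomial (V × Fin d) ℤ) :
    k ^ 2 ≠ ∏ e ∈ T, edgePoly V d e := by
  classical
  obtain ⟨m, rfl⟩ := Nat.exists_eq_add_of_le' hd
  obtain ⟨e, he⟩ := hT
  induction e using Sym2.ind with
  | _ u v =>
  have huv : u ≠ v := by simpa using hdiag _ he
  obtain ⟨n, ⟨ν'⟩⟩ := Finite.exists_equiv_fin V
  let ν : V → ℂ := fun w => ((ν' w : ℕ) : ℂ)
  have hν : ∀ a b, a ≠ b → ν a - ν b ≠ 0 := by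
    intro a b hab h
    rw [sub_eq_zero] at h
    exact hab (ν'.injective (Fin.ext (Nat.cast_injective (R := ℂ) h)))
  -- In the isotropic coordinates `z`, `y` of a complex plane, the squared distance factors as `(z a
  -- - z b) * (y a - y b)`. All agents get distinct constants, except that `z u` is chosen to meet
  -- `z v` at `X = 0`.
  let z : V → Polynomial ℂ := fun w =>
    if w = u then Polynomial.X + Polynomial.C (ν v) else Polynomial.C (ν w)
  let y : V → Polynomial ℂ := fun w => Polynomial.C (ν w)
  let g : V × Fin (m + 2) → Polynomial ℂ := fun i =>
    Fin.cons (α := fun _ => Polynomial ℂ) (Polynomial.C (1 / 2) * (z i.1 + y i.1))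
      (Fin.cons (α := fun _ => Polynomial ℂ) (Polynomial.C (Complex.I / 2) * (z i.1 - y i.1)) 0) i.2
  have hφ : ∀ a b, aeval g (edgePoly V (m + 2) s(a, b)) = (z a - z b) * (y a - y b) := by
    intro a b
    have h1 : (Polynomial.C (1 / 2) : Polynomial ℂ) * Polynomial.C 2 = 1 := by
      rw [← Polynomial.C_mul]; norm_num
    have h2 : (Polynomial.C (Complex.I / 2) : Polynomial ℂ) ^ 2 =
        - Polynomial.C (1 / 2) ^ 2 := by
      rw [← Polynomial.C_pow, ← Polynomial.C_pow, ← Polynomial.C_neg]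
      congr 1
      rw [div_pow, Complex.I_sq]; norm_num
    have h3 : (Polynomial.C 2 : Polynomial ℂ) = 2 := rfl
    rw [edgePoly_mk, map_sum]
    simp only [map_pow, map_sub, aeval_X]
    rw [Fin.sum_univ_succ, Fin.sum_univ_succ]
    simp only [g, Fin.cons_zero, Fin.cons_succ, Pi.zero_apply]
    simp only [sub_zero, ne_eq, OfNat.ofNat_ne_zero, not_false_eq_true, zero_pow,
      Finset.sum_const_zero, add_zero]
    rw [h3] at h1
    linear_combination (z a - y a - (z b - y b)) ^ 2 * h2 +
      (z a - z b) * (y a - y b) * (Polynomial.C (1 / 2) * 2 + 1) * h1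
  intro hk
  have hk := congrArg (aeval g) hk
  rw [map_pow, map_prod, ← Finset.mul_prod_erase _ _ he, hφ] at hk
  set U := ∏ f ∈ T.erase s(u, v), aeval g (edgePoly V (m + 2) f) with hU
  have hz : (z u - z v) * (y u - y v) = Polynomial.X * Polynomial.C (ν u - ν v) := by
    simp [z, y, huv.symm]
  rw [hz] at hk
  -- At `X = 0` only the edge `s(u, v)` degenerates, so the product has a simple zero there, which a
  -- square cannot have.
  have hU0 : Polynomial.eval 0 U ≠ 0 := by
    rw [hU, Polynomial.eval_prod, Finset.prod_ne_zero_iff]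
    intro f hf
    rw [Finset.mem_erase] at hf
    induction f using Sym2.ind with
    | _ a b =>
    have hab : a ≠ b := by simpa using hdiag _ hf.2
    have hne := hf.1
    rw [hφ, Polynomial.eval_mul]
    refine mul_ne_zero ?_ (by simpa [y] using hν a b hab)
    have hzw : ∀ w, Polynomial.eval 0 (z w) = ν (if w = u then v else w) := by
      intro w
      simp only [z]
      split_ifs <;> simp
    rw [Polynomial.eval_sub, hzw, hzw]
    apply hν
    rw [ne_eq, Sym2.eq_iff] at hne
    grind
  have hX : Polynomial.X ∣ aeval g k := by
    rw [Polynomial.X_dvd_iff, Polynomial.coeff_zero_eq_eval_zero]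
    have := congrArg (Polynomial.eval 0) hk
    simpa using this
  obtain ⟨l, hl⟩ := hX
  rw [hl, mul_pow, sq Polynomial.X, mul_assoc, mul_assoc] at hk
  have hk := congrArg (Polynomial.eval 0) (mul_left_cancel₀ Polynomial.X_ne_zero hk)
  simp only [Polynomial.eval_mul, Polynomial.eval_X, zero_mul, Polynomial.eval_C] at hk
  exact mul_ne_zero (hν u v huv) hU0 hk.symm

/-- If the product were a quotient `p / q` of polynomials at `x`, genericity would turn its square
into an identity of polynomials. The polynomial ring being integrally closed, `q` divides `p`, and
the product of squared lengths would be a square. -/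
theorem prod_edgeDist_notMem [Finite V] (hd : 2 ≤ d) {x : Positions V d} (hx : GenericPositions x)
    {T : Finset (Sym2 V)} (hT : T.Nonempty) (hdiag : ∀ e ∈ T, ¬ e.IsDiag) :
    ∏ e ∈ T, edgeDist x e ∉ Subfield.closure (Set.range (coords x)) := by
  intro hmem
  have hrange : ∀ y ∈ Subring.closure (Set.range (coords x)),
      ∃ p : MvPolynomial (V × Fin d) ℤ, aeval (coords x) p = y := by
    intro y hy
    have : y ∈ Algebra.adjoin ℤ (Set.range (coords x)) := by
      rw [Algebra.adjoin_int]; exact hy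
    rwa [Algebra.adjoin_range_eq_range_aeval] at this
  obtain ⟨_, hy, _, hz, h⟩ := Subfield.mem_closure_iff.1 hmem
  obtain ⟨p, rfl⟩ := hrange _ hy
  obtain ⟨q, rfl⟩ := hrange _ hz
  have hprod : ∏ e ∈ T, edgeDist x e ≠ 0 := by
    rw [Finset.prod_ne_zero_iff]
    intro e he
    induction e using Sym2.ind with
    | _ u v =>
    have huv : u ≠ v := by simpa using hdiag _ he
    rw [edgeDist_mk, norm_ne_zero_iff, sub_ne_zero]
    exact (hx.injective (by omega)).ne huv
  have hq : aeval (coords x) q ≠ 0 := by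
    intro h0
    rw [h0, div_zero] at h
    exact hprod h.symm
  have hpoly : p ^ 2 = q ^ 2 * ∏ e ∈ T, edgePoly V d e := by
    have hinj : Function.Injective (aeval (R := ℤ) (coords x)) := hx
    apply hinj
    rw [map_mul, map_pow, map_pow, map_prod]
    simp_rw [aeval_edgePoly]
    rw [Finset.prod_pow, ← h]
    field_simp
  obtain ⟨k, rfl⟩ := (IsIntegrallyClosed.pow_dvd_pow_iff two_ne_zero).1 ⟨_, hpoly⟩
  have hq0 : q ^ 2 ≠ 0 := by
    rintro h0
    rw [pow_eq_zero_iff two_ne_zero] at h0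
    simp [h0] at hq
  rw [mul_pow] at hpoly
  exact sq_ne_prod_edgePoly hd hT hdiag k (mul_left_cancel₀ hq0 hpoly)

theorem edgeDist_sq_mem (x : Positions V d) (e : Sym2 V) :
    edgeDist x e ^ 2 ∈ Subfield.closure (Set.range (coords x)) := by
  induction e using Sym2.ind with
  | _ u v =>
  rw [edgeDist_mk, EuclideanSpace.real_norm_sq_eq]
  exact sum_mem fun k _ => pow_mem (sub_mem (Subfield.subset_closure (Set.mem_range_self (u, k)))
    (Subfield.subset_closure (Set.mem_range_self (v, k)))) 2

/-- Each distance is outside of the field generated by the coordinates and the other distances. -/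
theorem edgeDist_notMem [Finite V] (hd : 2 ≤ d) {x : Positions V d} (hx : GenericPositions x)
    {e : Sym2 V} (he : ¬ e.IsDiag) :
    edgeDist x e ∉ Subfield.closure ((Subfield.closure (Set.range (coords x)) : Set ℝ) ∪
      edgeDist x '' {f | f ≠ e ∧ ¬ f.IsDiag}) := by
  classical
  have := Fintype.ofFinite V
  have hsq := edgeDist_sq_mem x
  have := notMem_closure_union_image (Subfield.closure (Set.range (coords x))) (edgeDist x)
    (Finset.univ.filter fun f => f ≠ e ∧ ¬ f.IsDiag) (fun f _ => hsq f)
    (fun T hT hne => prod_edgeDist_notMem hd hx hne fun f hf =>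
      (Finset.mem_filter.1 (hT hf)).2.2) (edgeDist x e) (hsq e) (fun T hT => ?_)
  · simpa using this
  · have heT : e ∉ T := fun h => (Finset.mem_filter.1 (hT h)).2.1 rfl
    rw [← Finset.prod_insert heT]
    refine prod_edgeDist_notMem hd hx (Finset.insert_nonempty _ _) fun f hf => ?_
    rcases Finset.mem_insert.1 hf with rfl | hf
    · exact he
    · exact (Finset.mem_filter.1 (hT hf)).2.2

/-- A polynomial relation between the coordinates and the distances of a generic configuration
persists when the signs of the distances are changed arbitrarily. -/
theorem aeval_signs_eq_zero [Finite V] (hd : 2 ≤ d) {x : Positions V d} (hx : GenericPositions x)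
    {P : MvPolynomial ((V × Fin d) ⊕ Sym2 V) ℤ}
    (hP : aeval (Sum.elim (coords x) (edgeDist x)) P = 0) {s : Sym2 V → ℝ}
    (hs : ∀ e, s e = 1 ∨ s e = -1) :
    aeval (Sum.elim (coords x) (fun e => s e * edgeDist x e)) P = 0 := by
  classical
  have := Fintype.ofFinite V
  suffices H : ∀ W : Finset (Sym2 V),
      aeval (Sum.elim (coords x) (fun e => (if e ∈ W then s e else 1) * edgeDist x e)) P = 0 by
    simpa using H Finset.univ
  intro W
  induction W using Finset.induction_on with
  | empty => simpa using hP
  | insert e W heW ih =>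
    set a : (V × Fin d) ⊕ Sym2 V → ℝ :=
      Sum.elim (coords x) (fun e => (if e ∈ W then s e else 1) * edgeDist x e) with ha
    have hae : a (Sum.inr e) = edgeDist x e := by simp [ha, heW]
    -- Loops have length zero, so their sign is irrelevant.
    by_cases htriv : e.IsDiag ∨ s e = 1
    · convert ih using 2
      rw [ha]
      congr 1
      congr 1
      ext f
      by_cases hf : f = e
      · subst hf
        rcases htriv with h | h
        · simp [edgeDist_of_isDiag x h]
        · simp [h]
      · simp [hf]
    · rw [not_or] at htriv
      have hse := (hs e).resolve_left htriv.2
      have key : Sum.elim (coords x)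
          (fun f => (if f ∈ insert e W then s f else 1) * edgeDist x f) =
          Function.update a (Sum.inr e) (-a (Sum.inr e)) := by
        ext (i | f)
        · simp [ha]
        · by_cases hf : f = e
          · subst hf; simp [hae, hse]
          · simp [ha, hf]
      rw [key]
      have hK : Subfield.closure (Set.range (coords x)) ≤
          Subfield.closure ((Subfield.closure (Set.range (coords x)) : Set ℝ) ∪
            edgeDist x '' {f | f ≠ e ∧ ¬ f.IsDiag}) :=
        fun y hy => Subfield.subset_closure (Or.inl hy)
      refine aeval_update_neg_eq_zero ?_ (hae ▸ edgeDist_notMem hd hx htriv.1) ?_ ih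
      · rintro (i | f) hf
        · exact hK (Subfield.subset_closure ⟨i, rfl⟩)
        · have hfe : f ≠ e := fun h => hf (h ▸ rfl)
          have h1 : (if f ∈ W then s f else 1) = 1 ∨ (if f ∈ W then s f else 1) = -1 := by
            split_ifs
            · exact hs f
            · exact Or.inl rfl
          have hmem : edgeDist x f ∈
              Subfield.closure ((Subfield.closure (Set.range (coords x)) : Set ℝ) ∪
                edgeDist x '' {f | f ≠ e ∧ ¬ f.IsDiag}) := by
            by_cases hfd : f.IsDiag
            · rw [edgeDist_of_isDiag x hfd]
              exact Subfield.zero_mem _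
            · exact Subfield.subset_closure (Or.inr ⟨f, ⟨hfe, hfd⟩, rfl⟩)
          change (if f ∈ W then s f else 1) * edgeDist x f ∈ _
          rcases h1 with h1 | h1 <;> rw [h1]
          · rwa [one_mul]
          · rw [neg_one_mul]
            exact Subfield.neg_mem _ hmem
      · rw [hae]
        exact hK (edgeDist_sq_mem x e)

end Distances

/-! ### Coordinates of the rows of the rigidity matrices -/

section Rows

open MvPolynomial

variable {V : Type*} {d : ℕ} {R S : Type*} [CommRing R] [CommRing S]

open scoped Classical in
/-- The coordinates of the row of the distance rigidity matrix at the point `z`. -/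
noncomputable def distanceVec (z : V × Fin d → R) (a : V × V) : V × Fin d → R := fun i =>
  (z (a.1, i.2) - z (a.2, i.2)) * ((Pi.single a.1 1 - Pi.single a.2 1 : V → R) i.1)

open scoped Classical in
/-- The row of the incidence matrix. -/
noncomputable def incidenceVec (R : Type*) [CommRing R] (a : V × V) : V → R :=
  Pi.single a.1 1 - Pi.single a.2 1

/-- The coordinates of the row of the pseudorange rigidity matrix at positions `z`, where the
distances are replaced by `τ`. -/
noncomputable def pseudorangeVec (z : V × Fin d → R) (τ : Sym2 V → R) (a : V × V) :
    (V × Fin d) ⊕ V → R :=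
  Sum.elim (distanceVec z a) fun w => -τ s(a.1, a.2) * incidenceVec R a w

theorem map_incidenceVec (φ : R →+* S) (a : V × V) (w : V) :
    φ (incidenceVec R a w) = incidenceVec S a w := by
  simp only [incidenceVec, Pi.sub_apply, map_sub, Pi.single_apply]
  split_ifs <;> simp

theorem map_distanceVec (φ : R →+* S) (z : V × Fin d → R) (a : V × V) (i : V × Fin d) :
    φ (distanceVec z a i) = distanceVec (φ ∘ z) a i := by
  have := map_incidenceVec φ a i.1
  simp only [incidenceVec] at this
  simp only [distanceVec, map_mul, map_sub, this, Function.comp]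

theorem map_pseudorangeVec (φ : R →+* S) (z : V × Fin d → R) (τ : Sym2 V → R) (a : V × V)
    (j : (V × Fin d) ⊕ V) :
    φ (pseudorangeVec z τ a j) = pseudorangeVec (φ ∘ z) (φ ∘ τ) a j := by
  rcases j with i | w
  · exact map_distanceVec φ z a i
  · simp [pseudorangeVec, map_incidenceVec]

theorem distanceVec_swap (z : V × Fin d → R) (a : V × V) :
    distanceVec z a.swap = distanceVec z a := by
  ext i
  simp only [distanceVec, Prod.fst_swap, Prod.snd_swap, Pi.sub_apply]
  ring

theorem incidenceVec_swap (a : V × V) : incidenceVec R a.swap = -incidenceVec R a := by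
  simp [incidenceVec]

/-- The entries are integer polynomials in the coordinates, so the Gram determinant argument
applies; `y` need not be generic. -/
theorem linearIndepOn_distanceVec_of_generic [Fintype V] {x y : Positions V d} (hx : GenericPositions x)
    {I : Set (V × V)} (h : LinearIndepOn ℝ (distanceVec (coords y)) I) :
    LinearIndepOn ℝ (distanceVec (coords x)) I := by
  have key : ∀ z : V × Fin d → ℝ, (fun a i => aeval z (distanceVec
      (X : V × Fin d → MvPolynomial (V × Fin d) ℤ) a i)) = distanceVec z := by
    intro z
    ext a i
    have := map_distanceVec (aeval z : MvPolynomial (V × Fin d) ℤ →ₐ[ℤ] ℝ).toRingHom X a i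
    refine this.trans ?_
    congr 1
    ext j
    simp
  have := linearIndepOn_aeval_of_algebraicIndependent (distanceVec
    (X : V × Fin d → MvPolynomial (V × Fin d) ℤ)) (I := I) (x := coords x) (y := coords y) hx
  rw [key, key] at this
  exact this h

theorem linearIndepOn_pseudorangeVec_of_signs [Fintype V] (hd : 2 ≤ d) {x : Positions V d}
    (hx : GenericPositions x) {I : Set (V × V)} {s : Sym2 V → ℝ} (hs : ∀ e, s e = 1 ∨ s e = -1)
    (h : LinearIndepOn ℝ (pseudorangeVec (coords x) fun e => s e * edgeDist x e) I) :
    LinearIndepOn ℝ (pseudorangeVec (coords x) (edgeDist x)) I := by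
  let F : V × V → (V × Fin d) ⊕ V → MvPolynomial ((V × Fin d) ⊕ Sym2 V) ℤ :=
    pseudorangeVec (X ∘ Sum.inl) (X ∘ Sum.inr)
  have key : ∀ (z : V × Fin d → ℝ) (τ : Sym2 V → ℝ),
      (fun a i => aeval (Sum.elim z τ) (F a i)) = pseudorangeVec z τ := by
    intro z τ
    ext a i
    have := map_pseudorangeVec (aeval (Sum.elim z τ) :
      MvPolynomial ((V × Fin d) ⊕ Sym2 V) ℤ →ₐ[ℤ] ℝ).toRingHom (X ∘ Sum.inl) (X ∘ Sum.inr) a i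
    refine this.trans ?_
    congr 1
    · ext j; simp
    · ext j; simp
  rw [← key, ← aeval_gramDet_ne_zero_iff] at h ⊢
  exact fun h0 => h (aeval_signs_eq_zero hd hx h0 hs)

/-- Extension by zero on the right. -/
def inlVec (A B : Type*) : (A → ℝ) →ₗ[ℝ] (A ⊕ B → ℝ) where
  toFun f := Sum.elim f 0
  map_add' _ _ := by ext (_ | _) <;> simp
  map_smul' _ _ := by ext (_ | _) <;> simp

/-- Extension by zero on the left. -/
def inrVec (A B : Type*) : (B → ℝ) →ₗ[ℝ] (A ⊕ B → ℝ) where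
  toFun f := Sum.elim 0 f
  map_add' _ _ := by ext (_ | _) <;> simp
  map_smul' _ _ := by ext (_ | _) <;> simp

theorem ker_inlVec (A B : Type*) : (inlVec A B).ker = ⊥ :=
  LinearMap.ker_eq_bot.2 fun _ _ h => funext fun i => congrFun h (Sum.inl i)

theorem ker_inrVec (A B : Type*) : (inrVec A B).ker = ⊥ :=
  LinearMap.ker_eq_bot.2 fun _ _ h => funext fun i => congrFun h (Sum.inr i)

theorem disjoint_range_inlVec_inrVec (A B : Type*) :
    Disjoint (inlVec A B).range (inrVec A B).range := by
  rw [Submodule.disjoint_def]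
  rintro _ ⟨f, rfl⟩ ⟨g, hg⟩
  ext (i | i)
  · exact (congrFun hg (Sum.inl i)).symm
  · rfl

theorem pseudorangeVec_signs (x : Positions V d) (s : Sym2 V → ℝ) (a : V × V) :
    pseudorangeVec (coords x) (fun e => s e * edgeDist x e) a =
      inlVec _ _ (distanceVec (coords x) a) + s s(a.1, a.2) •
        inrVec _ _ (-edgeDist x s(a.1, a.2) • incidenceVec ℝ a) := by
  ext (i | w)
  · simp [pseudorangeVec, inlVec, inrVec]
  · simp [pseudorangeVec, inlVec, inrVec, mul_assoc]

theorem pseudorangeVec_eq (x : Positions V d) (a : V × V) :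
    pseudorangeVec (coords x) (edgeDist x) a =
      inlVec _ _ (distanceVec (coords x) a) +
        inrVec _ _ (-edgeDist x s(a.1, a.2) • incidenceVec ℝ a) := by
  simpa using pseudorangeVec_signs x (fun _ => 1) a

theorem incidenceVec_of_eq {a : V × V} (h : a.1 = a.2) : incidenceVec ℝ a = 0 := by
  simp [incidenceVec, h]

theorem linearIndepOn_comp_iff {α W W' : Type*} [AddCommGroup W] [Module ℝ W] [AddCommGroup W']
    [Module ℝ W'] {φ : W →ₗ[ℝ] W'} (hφ : φ.ker = ⊥) {f : α → W} {I : Set α} :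
    LinearIndepOn ℝ (fun a => φ (f a)) I ↔ LinearIndepOn ℝ f I :=
  φ.linearIndependent_iff hφ

/-- If a family of multiples is independent, so is the family. -/
theorem linearIndepOn_of_smul {α W : Type*} [AddCommGroup W] [Module ℝ W] {r : α → ℝ}
    {f : α → W} {I : Set α} (h : LinearIndepOn ℝ (fun a => r a • f a) I) :
    LinearIndepOn ℝ f I := by
  have hr : ∀ a : I, r a ≠ 0 := fun a h0 => h.ne_zero a.2 (by simp [h0])
  exact (LinearIndependent.units_smul_iff (v := fun a : I => f a)
    (w := fun a => Units.mk0 (r a) (hr a))).1 h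

theorem linearIndepOn_smul_of_ne_zero {α W : Type*} [AddCommGroup W] [Module ℝ W] {r : α → ℝ}
    {f : α → W} {I : Set α} (h : LinearIndepOn ℝ f I) (hr : ∀ a ∈ I, r a ≠ 0) :
    LinearIndepOn ℝ (fun a => r a • f a) I :=
  (LinearIndependent.units_smul_iff (v := fun a : I => f a)
    (w := fun a => Units.mk0 (r a) (hr a a.2))).2 h

/-- An independent set of the pseudorange matrix splits into an independent set of the distance
matrix and an independent set of the incidence matrix. -/
theorem exists_split_of_linearIndepOn_pseudorangeVec [Fintype V] {x : Positions V d} {I : Set (V × V)}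
    (h : LinearIndepOn ℝ (pseudorangeVec (coords x) (edgeDist x)) I) :
    ∃ K ⊆ I, LinearIndepOn ℝ (distanceVec (coords x)) K ∧
      LinearIndepOn ℝ (incidenceVec ℝ) (I \ K) := by
  have h' := h.congr fun a _ => pseudorangeVec_eq x a
  obtain ⟨u, hu, hI⟩ := exists_linearIndepOn_ite h'
  refine ⟨{a ∈ I | u a = inlVec _ _ (distanceVec (coords x) a)}, Set.sep_subset _ _, ?_, ?_⟩
  · rw [← linearIndepOn_comp_iff (ker_inlVec _ V)]
    exact (hI.mono (Set.sep_subset _ _)).congr fun a ha => ha.2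
  · apply linearIndepOn_of_smul (r := fun a => -edgeDist x s(a.1, a.2))
    rw [← linearIndepOn_comp_iff (ker_inrVec (V × Fin d) _)]
    exact (hI.mono Set.sdiff_subset).congr fun a ha =>
      (hu a).resolve_left fun h => ha.2 ⟨ha.1, h⟩

/-- Conversely, at a generic point, unions of independent sets of the distance matrix and of the
incidence matrix are independent in the pseudorange matrix. -/
theorem linearIndepOn_pseudorangeVec_union [Fintype V] (hd : 2 ≤ d) {x : Positions V d}
    (hx : GenericPositions x) {K L : Set (V × V)}
    (hK : LinearIndepOn ℝ (distanceVec (coords x)) K) (hL : LinearIndepOn ℝ (incidenceVec ℝ) L) :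
    LinearIndepOn ℝ (pseudorangeVec (coords x) (edgeDist x)) (K ∪ L) := by
  classical
  let v : V × V → (V × Fin d) ⊕ V → ℝ := fun a => inlVec _ _ (distanceVec (coords x) a)
  let w : V × V → (V × Fin d) ⊕ V → ℝ := fun a =>
    inrVec _ _ (-edgeDist x s(a.1, a.2) • incidenceVec ℝ a)
  have hv : LinearIndepOn ℝ v K := (linearIndepOn_comp_iff (ker_inlVec _ _)).2 hK
  have hw : LinearIndepOn ℝ w L := by
    have hs := linearIndepOn_smul_of_ne_zero (r := fun a => -edgeDist x s(a.1, a.2)) hL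
    refine (linearIndepOn_comp_iff (ker_inrVec (V × Fin d) V)).2 (hs fun a ha => ?_)
    have hne : a.1 ≠ a.2 := fun h => hL.ne_zero ha (incidenceVec_of_eq h)
    rw [edgeDist_mk, neg_ne_zero, norm_ne_zero_iff, sub_ne_zero]
    exact (hx.injective (by omega)).ne hne
  -- On `K ∩ L` the distance summand is kept. Independence on the union holds because the two kinds
  -- of summands lie in complementary subspaces.
  let u : V × V → (V × Fin d) ⊕ V → ℝ := fun a => if a ∈ K then v a else w a
  have huK : LinearIndepOn ℝ u K := hv.congr fun a ha => by simp [u, ha]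
  have huL : LinearIndepOn ℝ u (L \ K) :=
    (hw.mono Set.sdiff_subset).congr fun a ha => by simp [u, ha.2]
  have huI : LinearIndepOn ℝ u (K ∪ L) := by
    rw [← Set.union_sdiff_self]
    refine huK.union huL ((disjoint_range_inlVec_inrVec _ _).mono ?_ ?_)
    · rw [Submodule.span_le]
      rintro _ ⟨a, ha, rfl⟩
      exact ⟨distanceVec (coords x) a, by simp [u, ha, v]⟩
    · rw [Submodule.span_le]
      rintro _ ⟨a, ha, rfl⟩
      exact ⟨-edgeDist x s(a.1, a.2) • incidenceVec ℝ a, by simp only [u, ha.2, if_false, w]⟩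
  -- Opposite arcs share one length, hence one sign; their distance rows agree and their incidence
  -- rows are opposite.
  have hκ : ∀ a b : V × V, a ≠ b → s(a.1, a.2) = s(b.1, b.2) → v a = v b ∧ w a = -w b := by
    intro a b hab h
    have hba : a = b.swap := by
      rcases Sym2.eq_iff.1 h with h | h
      · exact absurd (Prod.ext h.1 h.2) hab
      · exact Prod.ext h.1 h.2
    subst hba
    refine ⟨by simp only [v, distanceVec_swap], ?_⟩
    simp only [w, incidenceVec_swap, Prod.fst_swap, Prod.snd_swap, smul_neg, map_neg,
      Sym2.eq_swap (a := b.2)]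
  obtain ⟨s, hs, hsI⟩ := exists_signs (κ := fun a : V × V => s(a.1, a.2))
    (fun a _ => by simp only [u]; split_ifs <;> simp) hκ huI
  exact linearIndepOn_pseudorangeVec_of_signs hd hx hs
    (hsI.congr fun a _ => (pseudorangeVec_signs x s a).symm)

/-- Forests are the independent sets of the incidence matrix. -/
theorem isForest_iff_linearIndepOn [Fintype V] {I : Set (V × V)} :
    IsForest I ↔ LinearIndepOn ℝ (incidenceVec ℝ) I := by
  refine ⟨fun h => h.linearIndepOn, fun h => ?_⟩
  induction I, Set.toFinite I using Set.Finite.induction_on with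
  | empty =>
    refine ⟨fun _ _ h => absurd h (Set.notMem_empty _), ?_⟩
    have : arcGraph (∅ : Set (V × V)) = ⊥ := by
      ext u v
      simp [arcGraph]
    rw [this]
    exact SimpleGraph.isAcyclic_bot
  | @insert a I ha _ ih =>
    rw [linearIndepOn_insert ha] at h
    exact (ih h.1).insert fun hr => h.2 (single_sub_single_mem_span hr)

/-- Joining two different components of a forest by an arc gives a forest, whose incidence rows are
again independent. -/
theorem reachable_of_mem_span [Fintype V] {I : Set (V × V)} {u v : V} (hI : LinearIndepOn ℝ (incidenceVec ℝ) I)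
    (h : incidenceVec ℝ (u, v) ∈ Submodule.span ℝ (incidenceVec ℝ '' I)) :
    (arcGraph I).Reachable u v := by
  by_contra hr
  have h1 := isForest_iff_linearIndepOn.1 ((isForest_iff_linearIndepOn.2 hI).insert (a := (u, v)) hr)
  have hn : (u, v) ∉ I := by
    intro hm
    refine hr (SimpleGraph.Adj.reachable ?_)
    simp only [arcGraph, SimpleGraph.fromRel_adj]
    refine ⟨?_, Or.inl hm⟩
    rintro rfl
    exact hr (SimpleGraph.Reachable.refl _)
  exact ((linearIndepOn_insert hn).1 h1).2 h

/-- Dependence of the pseudorange matrix at a generic point implies dependence everywhere. -/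
theorem linearIndepOn_pseudorangeVec_of_generic [Fintype V] (hd : 2 ≤ d) {x y : Positions V d}
    (hx : GenericPositions x) {I : Set (V × V)}
    (h : LinearIndepOn ℝ (pseudorangeVec (coords y) (edgeDist y)) I) :
    LinearIndepOn ℝ (pseudorangeVec (coords x) (edgeDist x)) I := by
  obtain ⟨K, hKI, hK, hL⟩ := exists_split_of_linearIndepOn_pseudorangeVec h
  have := linearIndepOn_pseudorangeVec_union hd hx (linearIndepOn_distanceVec_of_generic hx hK) hL
  rwa [Set.union_sdiff_cancel hKI] at this

end Rows

/-! ### Functions with dependent derivatives -/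

section Analysis

variable {α C : Type*} [Finite α] [NormedAddCommGroup C] [NormedSpace ℝ C] [FiniteDimensional ℝ C]

omit [Finite α] [FiniteDimensional ℝ C] in
theorem range_pi_eq_top {ι : Type*} [Fintype ι] {D : ι → C →L[ℝ] ℝ}
    (hD : LinearIndependent ℝ D) : (ContinuousLinearMap.pi D).range = ⊤ := by
  classical
  by_contra hne
  obtain ⟨φ, hφ, hle⟩ := Submodule.exists_le_ker_of_lt_top _ (lt_top_iff_ne_top.2 hne)
  apply hφ
  have hsum : ∑ i, φ (Pi.single i 1) • D i = 0 := by
    ext q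
    have hq : φ (ContinuousLinearMap.pi D q) = 0 := hle ⟨q, rfl⟩
    rw [LinearMap.pi_apply_eq_sum_univ φ] at hq
    simp only [sum_apply, smul_apply, smul_eq_mul,
      zero_apply]
    rw [← hq]
    refine Finset.sum_congr rfl fun i _ => ?_
    rw [smul_eq_mul, mul_comm]
    congr 2
    ext j
    simp [Pi.single_apply, eq_comm]
  have h0 := Fintype.linearIndependent_iff.1 hD _ hsum
  ext i
  simpa using h0 i

/-- If near `p` the derivative of `f b` is a combination of the derivatives of the `f a`, `a ∈ I`,
and the latter are independent at `p`, then `f b` is constant on the fibre of the `f a`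
through `p`, locally at `p`. -/
theorem eventually_eq_of_fderiv_mem_span {f : α → C → ℝ} {p : C} {I : Set α} {b : α}
    (hf : ∀ a ∈ insert b I, ContDiffAt ℝ 1 (f a) p)
    (hI : LinearIndepOn ℝ (fun a => fderiv ℝ (f a) p) I)
    (hspan : ∀ᶠ q in 𝓝 p, fderiv ℝ (f b) q ∈
      Submodule.span ℝ ((fun a => fderiv ℝ (f a) q) '' I)) :
    ∀ᶠ q in 𝓝 p, (∀ a ∈ I, f a q = f a p) → f b q = f b p := by
  classical
  have := Fintype.ofFinite I
  have hcomp : CompleteSpace C := FiniteDimensional.complete ℝ C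
  let F : C → I → ℝ := fun q a => f a q
  let F' : C →L[ℝ] I → ℝ := ContinuousLinearMap.pi fun a : I => fderiv ℝ (f a) p
  have hFtop : F'.range = ⊤ := range_pi_eq_top hI
  let N : Submodule ℝ C := F'.ker
  obtain ⟨π₀, hπ₀⟩ := N.subtype.exists_leftInverse_of_injective N.ker_subtype
  let π : C →L[ℝ] N := LinearMap.toContinuousLinearMap π₀
  have hπ : ∀ k : N, π k = k := fun k => LinearMap.congr_fun hπ₀ k
  -- Completing `F` by a projection onto the kernel of its derivative gives a local chart in which
  -- the fibres of `F` are slices with fixed first component.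
  let G : C → (I → ℝ) × N := fun q => (F q, π q)
  let A₀ : C →L[ℝ] (I → ℝ) × N := F'.prod π
  have hA₀ : Function.Bijective A₀ := by
    constructor
    · rw [injective_iff_map_eq_zero]
      intro q hq
      have h1 : F' q = 0 := congrArg Prod.fst hq
      have h2 : π q = 0 := congrArg Prod.snd hq
      have h3 := hπ ⟨q, h1⟩
      rw [h2] at h3
      exact (congrArg Subtype.val h3).symm
    · rintro ⟨y, k⟩
      obtain ⟨q, hq⟩ : y ∈ F'.range := hFtop ▸ Submodule.mem_top
      refine ⟨q + (k - π q : N), Prod.ext ?_ ?_⟩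
      · have : F' ((k - π q : N) : C) = 0 := (k - π q).2
        change F' (q + (k - π q : N)) = y
        rw [map_add, this, add_zero]
        exact hq
      · change π (q + (k - π q : N)) = k
        rw [map_add, hπ]
        abel
  let A : C ≃L[ℝ] (I → ℝ) × N :=
    (LinearEquiv.ofBijective (A₀ : C →ₗ[ℝ] (I → ℝ) × N) hA₀).toContinuousLinearEquiv
  have hA : (A : C →L[ℝ] (I → ℝ) × N) = A₀ := by ext q <;> rfl
  have hFc : ContDiffAt ℝ 1 F p := contDiffAt_pi.2 fun a => hf a (Set.mem_insert_of_mem _ a.2)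
  have hG : ContDiffAt ℝ 1 G p := hFc.prodMk π.contDiff.contDiffAt
  have hG' : HasFDerivAt G (A : C →L[ℝ] (I → ℝ) × N) p := by
    rw [hA]
    refine HasFDerivAt.prodMk (hasFDerivAt_pi.2 fun a => ?_) π.hasFDerivAt
    exact ((hf a (Set.mem_insert_of_mem _ a.2)).differentiableAt one_ne_zero).hasFDerivAt
  let e := hG.toOpenPartialHomeomorph G hG' one_ne_zero
  have hps : p ∈ e.source := hG.mem_toOpenPartialHomeomorph_source hG' one_ne_zero
  have hpt : G p ∈ e.target := e.map_source hps
  have hep : e.symm (G p) = p := e.left_inv hps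
  have hsymm : ContDiffAt ℝ 1 e.symm (G p) := hG.to_localInverse hG' one_ne_zero
  have hcont : Filter.Tendsto e.symm (𝓝 (G p)) (𝓝 p) := by
    have := hsymm.continuousAt.tendsto
    rwa [hep] at this
  have hdf : ∀ᶠ q in 𝓝 p, ∀ a ∈ insert b I, DifferentiableAt ℝ (f a) q := by
    rw [Filter.eventually_all_finite (Set.toFinite _)]
    intro a ha
    exact ((hf a ha).eventually (by simp)).mono fun q hq => hq.differentiableAt one_ne_zero
  have hev : ∀ᶠ y in 𝓝 (G p), y ∈ e.target ∧ DifferentiableAt ℝ e.symm y ∧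
      (∀ a ∈ insert b I, DifferentiableAt ℝ (f a) (e.symm y)) ∧
      fderiv ℝ (f b) (e.symm y) ∈
        Submodule.span ℝ ((fun a => fderiv ℝ (f a) (e.symm y)) '' I) :=
    (e.open_target.eventually_mem hpt).and
      (((hsymm.eventually (by simp)).mono fun q hq => hq.differentiableAt one_ne_zero).and
        ((hcont.eventually hdf).and (hcont.eventually hspan)))
  obtain ⟨r, hr, hball⟩ := Metric.eventually_nhds_iff_ball.1 hev
  have hmem : ∀ k ∈ Metric.ball (π p) r, (F p, k) ∈ Metric.ball (G p) r := by
    intro k hk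
    rw [Metric.mem_ball, Prod.dist_eq]
    simpa [G, hr] using hk
  have hderiv : ∀ k ∈ Metric.ball (π p) r,
      HasFDerivAt (fun k => f b (e.symm (F p, k))) (0 : N →L[ℝ] ℝ) k := by
    intro k hk
    obtain ⟨-, hd1, hd2, hsp⟩ := hball _ (hmem k hk)
    set q := e.symm (F p, k) with hq
    let l : N →L[ℝ] C := (fderiv ℝ e.symm (F p, k)).comp (ContinuousLinearMap.inr ℝ (I → ℝ) N)
    have hl : HasFDerivAt (fun k : N => e.symm (F p, k)) l k :=
      hd1.hasFDerivAt.comp k (hasFDerivAt_prodMk_right (F p) k)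
    have hcompose : ∀ a ∈ insert b I,
        HasFDerivAt (fun k : N => f a (e.symm (F p, k))) ((fderiv ℝ (f a) q).comp l) k :=
      fun a ha => (hd2 a ha).hasFDerivAt.comp k hl
    -- Each `f a` is constant on the slice through `p`, so its derivative kills the tangent
    -- directions; so does every combination, in particular that of `f b`.
    have hzero : ∀ a ∈ I, (fderiv ℝ (f a) q).comp l = 0 := by
      intro a ha
      refine (hcompose a (Set.mem_insert_of_mem _ ha)).unique ?_
      refine (hasFDerivAt_const (f a p) k).congr_of_eventuallyEq ?_
      filter_upwards [Metric.isOpen_ball.mem_nhds hk] with k' hk'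
      have h1 : G (e.symm (F p, k')) = (F p, k') := e.right_inv (hball _ (hmem k' hk')).1
      exact congrFun (congrArg Prod.fst h1) ⟨a, ha⟩
    have hb : (fderiv ℝ (f b) q).comp l = 0 := by
      have hle : Submodule.span ℝ ((fun a => fderiv ℝ (f a) q) '' I) ≤
          LinearMap.ker ((ContinuousLinearMap.precomp ℝ l : (C →L[ℝ] ℝ) →L[ℝ] (N →L[ℝ] ℝ)) :
            (C →L[ℝ] ℝ) →ₗ[ℝ] (N →L[ℝ] ℝ)) := by
        rw [Submodule.span_le]
        rintro _ ⟨a, ha, rfl⟩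
        exact hzero a ha
      exact hle hsp
    rw [← hb]
    exact hcompose b (Set.mem_insert _ _)
  have hconst : ∀ k ∈ Metric.ball (π p) r, f b (e.symm (F p, k)) = f b (e.symm (F p, π p)) :=
    fun k hk => Metric.isOpen_ball.is_const_of_fderiv_eq_zero (𝕜 := ℝ)
      (convex_ball (π p) r).isPreconnected
      (fun k hk => (hderiv k hk).differentiableAt.differentiableWithinAt)
      (fun k hk => (hderiv k hk).fderiv) hk (Metric.mem_ball_self hr)
  filter_upwards [e.open_source.mem_nhds hps,
    π.continuous.continuousAt.eventually (Metric.ball_mem_nhds (π p) hr)] with q hq hπq hfq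
  have hFq : F q = F p := funext fun a => hfq a a.2
  have h1 : e.symm (F p, π q) = q := by
    rw [← hFq]
    exact e.left_inv hq
  have h2 : e.symm (F p, π p) = p := hep
  rw [← h1, hconst _ hπq, h2]

/-- A function with derivative independent of the derivatives of the others takes other values on
the fibre of the others, arbitrarily close to `p`. -/
theorem frequently_ne_of_linearIndepOn_fderiv {f : α → C → ℝ} {p : C} {J : Set α} {b : α}
    (hb : b ∈ J) (hf : ∀ a ∈ J, ContDiffAt ℝ 1 (f a) p)
    (hJ : LinearIndepOn ℝ (fun a => fderiv ℝ (f a) p) J) :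
    ∃ᶠ q in 𝓝 p, (∀ a ∈ J, a ≠ b → f a q = f a p) ∧ f b q ≠ f b p := by
  classical
  have := Fintype.ofFinite J
  have hcomp : CompleteSpace C := FiniteDimensional.complete ℝ C
  let F : C → J → ℝ := fun q a => f a q
  have hF : HasStrictFDerivAt F (ContinuousLinearMap.pi fun a : J => fderiv ℝ (f a) p) p :=
    hasStrictFDerivAt_pi.2 fun a => (hf a a.2).hasStrictFDerivAt one_ne_zero
  -- `F` is a submersion, so it maps neighbourhoods onto neighbourhoods, and the value at `b` can be
  -- varied alone.
  have hmap := hF.map_nhds_eq_of_surj (range_pi_eq_top hJ)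
  have hfreq : ∃ᶠ y in 𝓝 (F p), (∀ a : J, a.1 ≠ b → y a = F p a) ∧ y ⟨b, hb⟩ ≠ F p ⟨b, hb⟩ := by
    have ht : Filter.Tendsto (fun t : ℝ => Function.update (F p) ⟨b, hb⟩ t)
        (𝓝[≠] (F p ⟨b, hb⟩)) (𝓝 (F p)) := by
      have hc : Continuous fun t : ℝ => Function.update (F p) ⟨b, hb⟩ t :=
        continuous_const.update _ continuous_id
      have := hc.tendsto (F p ⟨b, hb⟩)
      rw [Function.update_eq_self] at this
      exact this.mono_left nhdsWithin_le_nhds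
    refine ht.frequently (Filter.Eventually.frequently ?_)
    filter_upwards [self_mem_nhdsWithin] with t ht
    refine ⟨fun a ha => ?_, by simpa using ht⟩
    rw [Function.update_of_ne]
    exact fun h => ha (congrArg Subtype.val h)
  rw [← hmap, Filter.frequently_map] at hfreq
  exact hfreq.mono fun q hq => ⟨fun a ha hab => hq.1 ⟨a, ha⟩ hab, hq.2⟩

end Analysis

/-! ### Rigidity of generic frameworks and rows of the rigidity matrix -/

section Rigidity

variable {V C : Type*} [Finite V] [NormedAddCommGroup C] [NormedSpace ℝ C]
  [FiniteDimensional ℝ C] {f : V × V → C → ℝ} {c : C → V × V → ℝ} {p : C}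

/-- Dependence at `p` persists nearby: the rows of `I` stay independent, so if the row of `b` left
their span at some `q`, then `hgen` would carry the independence of `insert b I` back to `p`. -/
theorem eventually_eq_of_row_mem_span (hf : ∀ a : V × V, a.1 ≠ a.2 → ContDiffAt ℝ 1 (f a) p)
    (hc : ∀ᶠ q in 𝓝 p, ∀ a : V × V, a.1 ≠ a.2 → c q a ≠ 0)
    (hgen : ∀ (q : C) (J : Set (V × V)), LinearIndepOn ℝ (fun a => c q a • fderiv ℝ (f a) q) J →
      LinearIndepOn ℝ (fun a => c p a • fderiv ℝ (f a) p) J)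
    {I : Set (V × V)} {b : V × V} (hIne : ∀ a ∈ I, a.1 ≠ a.2) (hb : b.1 ≠ b.2)
    (hI : LinearIndepOn ℝ (fun a => c p a • fderiv ℝ (f a) p) I)
    (hspan : c p b • fderiv ℝ (f b) p ∈
      Submodule.span ℝ ((fun a => c p a • fderiv ℝ (f a) p) '' I)) :
    ∀ᶠ q in 𝓝 p, (∀ a ∈ I, f a q = f a p) → f b q = f b p := by
  by_cases hbI : b ∈ I
  · exact Filter.Eventually.of_forall fun q hq => hq b hbI
  have hI' : LinearIndepOn ℝ (fun a => fderiv ℝ (f a) p) I := linearIndepOn_of_smul hI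
  have hins : ∀ a ∈ insert b I, a.1 ≠ a.2 := by
    rintro a (rfl | ha)
    · exact hb
    · exact hIne a ha
  refine eventually_eq_of_fderiv_mem_span (fun a ha => hf a (hins a ha)) hI' ?_
  have hcont : ContinuousAt (fun q => fun a : I => fderiv ℝ (f a) q) p :=
    continuousAt_pi.2 fun a => ((hf a (hIne a a.2)).fderiv_right (m := 0) le_rfl).continuousAt
  have hev := hcont.eventually (LinearIndependent.eventually hI')
  filter_upwards [hev, hc] with q hq hcq
  by_contra hn
  have h1 : LinearIndepOn ℝ (fun a => fderiv ℝ (f a) q) (insert b I) :=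
    (linearIndepOn_insert hbI).2 ⟨hq, hn⟩
  have h2 := hgen q _ (linearIndepOn_smul_of_ne_zero (r := c q) h1 fun a ha => hcq a (hins a ha))
  exact ((linearIndepOn_insert hbI).1 h2).2 hspan

/-- At a point where the rank of the rigidity matrix is maximal, a framework is rigid if and only
if all the rows are in the span of the rows of its edges. -/
theorem isRigidFramework_iff (hf : ∀ a : V × V, a.1 ≠ a.2 → ContDiffAt ℝ 1 (f a) p)
    (hc : ∀ᶠ q in 𝓝 p, ∀ a : V × V, a.1 ≠ a.2 → c q a ≠ 0)
    (hgen : ∀ (q : C) (J : Set (V × V)), LinearIndepOn ℝ (fun a => c q a • fderiv ℝ (f a) q) J →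
      LinearIndepOn ℝ (fun a => c p a • fderiv ℝ (f a) p) J)
    {E : Set (V × V)} (hE : ∀ a ∈ E, a.1 ≠ a.2) :
    IsRigidFramework f E p ↔ ∀ b : V × V, b.1 ≠ b.2 → c p b • fderiv ℝ (f b) p ∈
      Submodule.span ℝ ((fun a => c p a • fderiv ℝ (f a) p) '' E) := by
  obtain ⟨I, hIE, -, hEI, hI⟩ := exists_linearIndepOn_extension
    (linearIndepOn_empty ℝ fun a => c p a • fderiv ℝ (f a) p) (Set.empty_subset E)
  have hIne : ∀ a ∈ I, a.1 ≠ a.2 := fun a ha => hE a (hIE ha)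
  have hspan := Submodule.span_le.2 hEI
  constructor
  · intro h b hb
    by_contra hn
    have hnI : c p b • fderiv ℝ (f b) p ∉
        Submodule.span ℝ ((fun a => c p a • fderiv ℝ (f a) p) '' I) :=
      fun hm => hn (Submodule.span_mono (Set.image_mono hIE) hm)
    have hbI : b ∉ I := fun hm => hnI (Submodule.subset_span ⟨b, hm, rfl⟩)
    have hJ := linearIndepOn_of_smul ((linearIndepOn_insert hbI).2 ⟨hI, hnI⟩)
    have hfreq := frequently_ne_of_linearIndepOn_fderiv (Set.mem_insert b I)
      (fun a ha => hf a (by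
        rcases ha with rfl | ha
        · exact hb
        · exact hIne a ha)) hJ
    have hev : ∀ᶠ q in 𝓝 p, ∀ a ∈ E, (∀ a ∈ I, f a q = f a p) → f a q = f a p :=
      (Filter.eventually_all_finite (Set.toFinite E)).2 fun a ha =>
        eventually_eq_of_row_mem_span hf hc hgen hIne (hE a ha) hI (hEI ⟨a, ha, rfl⟩)
    -- Near `p`, preserving the constraints of the basis `I` preserves all those of `E`, so a point
    -- that changes only `f b` contradicts rigidity.
    obtain ⟨q, hq, hqE, hqr⟩ := (hfreq.and_eventually (hev.and h)).exists
    have hqI : ∀ a ∈ I, f a q = f a p := fun a ha =>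
      hq.1 a (Set.mem_insert_of_mem _ ha) (by rintro rfl; exact hbI ha)
    exact hq.2 (hqr (fun a ha => (hqE a ha hqI).symm) b.1 b.2 hb).symm
  · intro h
    have hev : ∀ᶠ q in 𝓝 p, ∀ b ∈ {b : V × V | b.1 ≠ b.2},
        (∀ a ∈ I, f a q = f a p) → f b q = f b p :=
      (Filter.eventually_all_finite (Set.toFinite _)).2 fun b hb =>
        eventually_eq_of_row_mem_span hf hc hgen hIne hb hI (hspan (h b hb))
    filter_upwards [hev] with q hq hqE u v huv
    exact (hq (u, v) huv fun a ha => (hqE a (hIE ha)).symm).symm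

end Rigidity

theorem mem_span_comp_iff {α W W' : Type*} [AddCommGroup W] [Module ℝ W] [AddCommGroup W']
    [Module ℝ W'] {φ : W →ₗ[ℝ] W'} (hφ : φ.ker = ⊥) {g : α → W} {E : Set α} {w : W} :
    φ w ∈ Submodule.span ℝ ((fun a => φ (g a)) '' E) ↔ w ∈ Submodule.span ℝ (g '' E) := by
  rw [← Set.image_image φ g, Submodule.span_image, Submodule.mem_map]
  constructor
  · rintro ⟨y, hy, h⟩
    rwa [← LinearMap.ker_eq_bot.1 hφ h]
  · exact fun h => ⟨w, h, rfl⟩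

/-! ### The rows of the two rigidity matrices -/

section RowFunctionals

variable {V : Type*} [Fintype V] {d : ℕ}

/-- The functional on velocities with given coordinates. -/
noncomputable def distanceFunctional (V : Type*) [Fintype V] (d : ℕ) :
    (V × Fin d → ℝ) →ₗ[ℝ] (Positions V d →L[ℝ] ℝ) :=
  Fintype.linearCombination ℝ fun i : V × Fin d =>
    (EuclideanSpace.proj i.2 : EuclideanSpace ℝ (Fin d) →L[ℝ] ℝ).comp
      (ContinuousLinearMap.proj i.1)

theorem distanceFunctional_apply (g : V × Fin d → ℝ) (q : Positions V d) :
    distanceFunctional V d g q = ∑ i, g i * q i.1 i.2 := by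
  simp [distanceFunctional, Fintype.linearCombination_apply, sum_apply]

theorem ker_distanceFunctional : (distanceFunctional V d).ker = ⊥ := by
  classical
  rw [LinearMap.ker_eq_bot']
  intro g hg
  ext ⟨v, k⟩
  have := DFunLike.congr_fun hg (Pi.single v (EuclideanSpace.single k 1))
  rw [distanceFunctional_apply, Finset.sum_eq_single (v, k)] at this
  · simpa using this
  · rintro ⟨w, l⟩ - hne
    by_cases hw : w = v
    · subst hw
      have : l ≠ k := fun h => hne (by rw [h])
      simp [this]
    · simp [hw]
  · simp

/-- The functional on velocities and bias variations with given coordinates. -/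
noncomputable def pseudorangeFunctional (V : Type*) [Fintype V] (d : ℕ) :
    ((V × Fin d) ⊕ V → ℝ) →ₗ[ℝ] (Config V d →L[ℝ] ℝ) :=
  Fintype.linearCombination ℝ (Sum.elim
    (fun i : V × Fin d => ((EuclideanSpace.proj i.2 : EuclideanSpace ℝ (Fin d) →L[ℝ] ℝ).comp
      (ContinuousLinearMap.proj i.1)).comp (ContinuousLinearMap.fst ℝ _ _))
    (fun w => (ContinuousLinearMap.proj w : (V → ℝ) →L[ℝ] ℝ).comp
      (ContinuousLinearMap.snd ℝ _ _)))

theorem pseudorangeFunctional_apply (g : (V × Fin d) ⊕ V → ℝ) (q : Config V d) :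
    pseudorangeFunctional V d g q =
      ∑ i, g (Sum.inl i) * q.1 i.1 i.2 + ∑ w, g (Sum.inr w) * q.2 w := by
  simp [pseudorangeFunctional, Fintype.linearCombination_apply, sum_apply]

theorem ker_pseudorangeFunctional : (pseudorangeFunctional V d).ker = ⊥ := by
  classical
  rw [LinearMap.ker_eq_bot']
  intro g hg
  have h1 : (fun i => g (Sum.inl i)) = 0 := by
    apply LinearMap.ker_eq_bot'.1 (ker_distanceFunctional (V := V) (d := d))
    ext q
    have := DFunLike.congr_fun hg (q, 0)
    rw [pseudorangeFunctional_apply] at this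
    rw [distanceFunctional_apply]
    simpa using this
  ext (i | w)
  · exact congrFun h1 i
  · have := DFunLike.congr_fun hg (0, Pi.single w 1)
    rw [pseudorangeFunctional_apply] at this
    simpa [Pi.single_apply] using this

theorem sum_distanceVec_mul (x q : Positions V d) (a : V × V) :
    ∑ i, distanceVec (coords x) a i * q i.1 i.2 =
      inner ℝ (x a.1 - x a.2) (q a.1 - q a.2) := by
  classical
  rw [Fintype.sum_prod_type_right, PiLp.inner_apply]
  refine Finset.sum_congr rfl fun k _ => ?_
  have : ∀ w, distanceVec (coords x) a (w, k) * q w k =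
      (if w = a.1 then (x a.1 k - x a.2 k) * q w k else 0) -
        (if w = a.2 then (x a.1 k - x a.2 k) * q w k else 0) := by
    intro w
    simp only [distanceVec, coords, Pi.sub_apply, Pi.single_apply]
    split_ifs <;> ring
  simp only [this, Finset.sum_sub_distrib, Finset.sum_ite_eq', Finset.mem_univ, if_true]
  simp only [PiLp.sub_apply, RCLike.inner_apply, conj_trivial]
  ring

theorem sum_incidenceVec_mul (a : V × V) (β : V → ℝ) :
    ∑ w, incidenceVec ℝ a w * β w = β a.1 - β a.2 := by
  classical
  have : ∀ w, incidenceVec ℝ a w * β w =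
      (if w = a.1 then β w else 0) - (if w = a.2 then β w else 0) := by
    intro w
    simp only [incidenceVec, Pi.sub_apply, Pi.single_apply]
    split_ifs <;> ring
  simp [this, Finset.sum_sub_distrib]

theorem contDiffAt_distanceConstraint {x : Positions V d} {a : V × V}
    (h : x a.1 ≠ x a.2) : ContDiffAt ℝ 1 (distanceConstraint a) x := by
  have h1 : ContDiffAt ℝ 1 (fun x : Positions V d => x a.1 - x a.2) x := by fun_prop
  exact h1.norm ℝ (sub_ne_zero.2 h)

theorem contDiffAt_pseudorangeConstraint {p : Config V d} {a : V × V}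
    (h : p.1 a.1 ≠ p.1 a.2) : ContDiffAt ℝ 1 (pseudorangeConstraint a) p := by
  have h1 : ContDiffAt ℝ 1 (fun p : Config V d => p.1 a.1 - p.1 a.2) p := by fun_prop
  have h2 := h1.norm ℝ (sub_ne_zero.2 h)
  have h3 : ContDiffAt ℝ 1 (fun p : Config V d => p.2 a.2) p := by fun_prop
  have h4 : ContDiffAt ℝ 1 (fun p : Config V d => p.2 a.1) p := by fun_prop
  exact (h2.add h3).sub h4

/-- Differentiating the squared norm gives twice the row. Where the two positions coincide the norm
is not differentiable, but the factor in front makes both sides vanish. -/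
theorem distanceRow_apply (x q : Positions V d) (a : V × V) :
    distanceRow x a q = inner ℝ (x a.1 - x a.2) (q a.1 - q a.2) := by
  by_cases h : x a.1 = x a.2
  · simp [distanceRow, h]
  have hd := ((contDiffAt_distanceConstraint h).differentiableAt one_ne_zero).hasFDerivAt
  have h2 := hd.pow 2
  have hl : HasFDerivAt (fun x : Positions V d => x a.1 - x a.2)
      (ContinuousLinearMap.proj (R := ℝ) a.1 - ContinuousLinearMap.proj a.2) x :=
    (ContinuousLinearMap.proj (R := ℝ) (φ := fun _ : V => EuclideanSpace ℝ (Fin d)) a.1 -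
      ContinuousLinearMap.proj a.2).hasFDerivAt
  have h3 := DFunLike.congr_fun (h2.unique hl.norm_sq) q
  simp only [distanceConstraint, Nat.add_one_sub_one, pow_one, nsmul_eq_mul, Nat.cast_ofNat,
    smul_apply, smul_eq_mul, ContinuousLinearMap.comp_apply, innerSL_apply_apply, sub_apply,
    ContinuousLinearMap.proj_apply] at h3
  rw [distanceRow, smul_apply, smul_eq_mul]
  linarith

theorem distanceRow_eq (x : Positions V d) (a : V × V) :
    distanceRow x a = distanceFunctional V d (distanceVec (coords x) a) := by
  ext q
  rw [distanceRow_apply, distanceFunctional_apply, sum_distanceVec_mul]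

theorem pseudorangeRow_eq (p : Config V d) (a : V × V) :
    pseudorangeRow p a =
      pseudorangeFunctional V d (pseudorangeVec (coords p.1) (edgeDist p.1) a) := by
  have hrhs : ∀ q : Config V d,
      pseudorangeFunctional V d (pseudorangeVec (coords p.1) (edgeDist p.1) a) q =
        distanceRow p.1 a q.1 + ‖p.1 a.1 - p.1 a.2‖ * (q.2 a.2 - q.2 a.1) := by
    intro q
    rw [pseudorangeFunctional_apply, distanceRow_apply, ← sum_distanceVec_mul]
    congr 1
    simp only [pseudorangeVec, Sum.elim_inr, edgeDist_mk, mul_assoc, ← Finset.mul_sum,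
      sum_incidenceVec_mul]
    ring
  by_cases h : p.1 a.1 = p.1 a.2
  · ext q <;> simp [hrhs, pseudorangeRow, distanceRow, h]
  have hd := ((contDiffAt_distanceConstraint h).differentiableAt one_ne_zero).hasFDerivAt
  have h1 : HasFDerivAt (fun p : Config V d => distanceConstraint a p.1)
      ((fderiv ℝ (distanceConstraint a) p.1).comp (ContinuousLinearMap.fst ℝ _ _)) p :=
    hd.comp p hasFDerivAt_fst
  let π : V → Config V d →L[ℝ] ℝ := fun v =>
    (ContinuousLinearMap.proj v).comp (ContinuousLinearMap.snd ℝ _ _)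
  have h2 : HasFDerivAt (pseudorangeConstraint a)
      (((fderiv ℝ (distanceConstraint a) p.1).comp (ContinuousLinearMap.fst ℝ _ _)) +
        π a.2 - π a.1) p := (h1.add (π a.2).hasFDerivAt).sub (π a.1).hasFDerivAt
  refine ContinuousLinearMap.ext fun q => ?_
  rw [hrhs, pseudorangeRow, h2.fderiv, distanceRow]
  simp [π]
  ring

theorem linearIndepOn_distanceRow_iff {x : Positions V d} {I : Set (V × V)} :
    LinearIndepOn ℝ (distanceRow x) I ↔ LinearIndepOn ℝ (distanceVec (coords x)) I := by
  rw [← linearIndepOn_comp_iff (ker_distanceFunctional (V := V) (d := d))]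
  simp_rw [← distanceRow_eq]

theorem linearIndepOn_pseudorangeRow_iff {p : Config V d} {I : Set (V × V)} :
    LinearIndepOn ℝ (pseudorangeRow p) I ↔
      LinearIndepOn ℝ (pseudorangeVec (coords p.1) (edgeDist p.1)) I := by
  rw [← linearIndepOn_comp_iff (ker_pseudorangeFunctional (V := V) (d := d))]
  simp_rw [← pseudorangeRow_eq]

/-- The pseudorange rigidity matroid is the union of the distance rigidity matroid and of the cycle
matroid. -/
theorem isMatroidUnion_pseudorangeMatroid (hd : 2 ≤ d) (Γ : Digraph V) {p : Config V d}
    {x : Positions V d} (hp : GenericConfig p) (hx : GenericPositions x) :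
    IsMatroidUnion (pseudorangeMatroid Γ p) (distanceMatroid Γ x) (cycleMatroid Γ) := by
  refine ⟨(Set.union_self _).symm, fun I => ?_⟩
  change (I ⊆ arcs Γ ∧ LinearIndepOn ℝ (pseudorangeRow p) I) ↔ ∃ I₁ I₂ : Set (V × V),
    (I₁ ⊆ arcs Γ ∧ LinearIndepOn ℝ (distanceRow x) I₁) ∧ (I₂ ⊆ arcs Γ ∧ IsForest I₂) ∧ I = I₁ ∪ I₂
  simp_rw [linearIndepOn_pseudorangeRow_iff, linearIndepOn_distanceRow_iff,
    isForest_iff_linearIndepOn]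
  constructor
  · rintro ⟨hI, h⟩
    obtain ⟨K, hKI, hK, hL⟩ := exists_split_of_linearIndepOn_pseudorangeVec h
    exact ⟨K, I \ K, ⟨hKI.trans hI, linearIndepOn_distanceVec_of_generic hx hK⟩,
      ⟨Set.sdiff_subset.trans hI, hL⟩, (Set.union_sdiff_cancel hKI).symm⟩
  · rintro ⟨K, L, ⟨hKE, hK⟩, ⟨hLE, hL⟩, rfl⟩
    exact ⟨Set.union_subset hKE hLE, linearIndepOn_pseudorangeVec_union hd hp
      (linearIndepOn_distanceVec_of_generic hp hK) hL⟩

omit [Fintype V] in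
theorem eventually_norm_sub_ne_zero [Finite V] {C : Type*} [TopologicalSpace C]
    {π : C → Positions V d} (hπ : Continuous π) {p : C} (h : Function.Injective (π p)) :
    ∀ᶠ q in 𝓝 p, ∀ a : V × V, a.1 ≠ a.2 → ‖π q a.1 - π q a.2‖ ≠ 0 := by
  rw [Filter.eventually_all]
  intro a
  rw [Filter.eventually_imp_distrib_left]
  intro ha
  have hc : Continuous fun q => ‖π q a.1 - π q a.2‖ :=
    (((continuous_apply a.1).comp hπ).sub ((continuous_apply a.2).comp hπ)).norm
  exact hc.continuousAt.eventually_ne (norm_ne_zero_iff.2 (sub_ne_zero.2 (h.ne ha)))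

theorem isRigidFramework_distanceConstraint_iff (hd : 0 < d) {x : Positions V d}
    (hx : GenericPositions x) {E : Set (V × V)} (hE : ∀ a ∈ E, a.1 ≠ a.2) :
    IsRigidFramework distanceConstraint E x ↔ ∀ b : V × V, b.1 ≠ b.2 →
      distanceVec (coords x) b ∈ Submodule.span ℝ (distanceVec (coords x) '' E) := by
  have hinj := hx.injective hd
  refine (isRigidFramework_iff (c := fun x a => ‖x a.1 - x a.2‖)
    (fun a ha => contDiffAt_distanceConstraint (hinj.ne ha))
    (eventually_norm_sub_ne_zero continuous_id hinj) (fun q J hJ => ?_) hE).trans ?_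
  · exact linearIndepOn_distanceRow_iff.2 (linearIndepOn_distanceVec_of_generic hx
      (linearIndepOn_distanceRow_iff.1 hJ))
  · change (∀ b : V × V, b.1 ≠ b.2 → distanceRow x b ∈
      Submodule.span ℝ ((fun a => distanceRow x a) '' E)) ↔ _
    simp_rw [distanceRow_eq, mem_span_comp_iff ker_distanceFunctional]

/-- The rows involve lengths and are not polynomial in the coordinates, so maximality at generic
points comes from splitting at `q` and reassembling at `p`. -/
theorem isRigidFramework_pseudorangeConstraint_iff (hd : 2 ≤ d) {p : Config V d}
    (hp : GenericConfig p) {E : Set (V × V)} (hE : ∀ a ∈ E, a.1 ≠ a.2) :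
    IsRigidFramework pseudorangeConstraint E p ↔ ∀ b : V × V, b.1 ≠ b.2 →
      pseudorangeVec (coords p.1) (edgeDist p.1) b ∈
        Submodule.span ℝ (pseudorangeVec (coords p.1) (edgeDist p.1) '' E) := by
  have hinj := GenericPositions.injective hp (by omega)
  refine (isRigidFramework_iff (c := fun p a => ‖p.1 a.1 - p.1 a.2‖)
    (fun a ha => contDiffAt_pseudorangeConstraint (hinj.ne ha))
    (eventually_norm_sub_ne_zero continuous_fst hinj) (fun q J hJ => ?_) hE).trans ?_
  · exact linearIndepOn_pseudorangeRow_iff.2 (linearIndepOn_pseudorangeVec_of_generic hd hp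
      (linearIndepOn_pseudorangeRow_iff.1 hJ))
  · change (∀ b : V × V, b.1 ≠ b.2 → pseudorangeRow p b ∈
      Submodule.span ℝ ((fun a => pseudorangeRow p a) '' E)) ↔ _
    simp_rw [pseudorangeRow_eq, mem_span_comp_iff ker_pseudorangeFunctional]

end RowFunctionals

/-! ### Directed graphs with a given underlying undirected graph -/

section Underlying

variable {V : Type*}

open scoped Classical in
theorem ncard_arcs_over (Γ : Digraph V) {u v : V} (huv : u ≠ v) :
    {a ∈ arcs Γ | s(a.1, a.2) = s(u, v)}.ncard =
      (if Γ.Adj u v then 1 else 0) + (if Γ.Adj v u then 1 else 0) := by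
  have h : {a ∈ arcs Γ | s(a.1, a.2) = s(u, v)} =
      (if Γ.Adj u v then {(u, v)} else ∅) ∪ (if Γ.Adj v u then {(v, u)} else ∅) := by
    ext ⟨a, b⟩
    simp only [arcs, Set.mem_ofPred_eq, Sym2.eq_iff, Set.mem_union]
    constructor
    · rintro ⟨h, ⟨rfl, rfl⟩ | ⟨rfl, rfl⟩⟩ <;> simp [h]
    · rintro (h | h) <;> split_ifs at h with hadj <;> simp_all
  have hne : ((u, v) : V × V) ≠ (v, u) := fun h => huv (congrArg Prod.fst h)
  rw [h]
  split_ifs <;> simp [Set.ncard_pair hne.symm]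

variable {Γ : Digraph V} {T : UndirectedGraph V}

theorem IsUnderlying.mult_eq_two_iff (hΓ : IsUnderlying Γ T) {u v : V} (huv : u ≠ v) :
    T.mult s(u, v) = 2 ↔ Γ.Adj u v ∧ Γ.Adj v u := by
  classical
  rw [hΓ, ncard_arcs_over Γ huv]
  split_ifs <;> simp_all

theorem IsUnderlying.mult_eq_one_or_two_iff (hΓ : IsUnderlying Γ T) {u v : V} (huv : u ≠ v) :
    T.mult s(u, v) = 1 ∨ T.mult s(u, v) = 2 ↔ Γ.Adj u v ∨ Γ.Adj v u := by
  classical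
  rw [hΓ, ncard_arcs_over Γ huv]
  split_ifs <;> simp_all

theorem IsUnderlying.ne [Finite V] (hΓ : IsUnderlying Γ T) {a : V × V} (ha : a ∈ arcs Γ) :
    a.1 ≠ a.2 := by
  intro h
  have h0 := T.mult_of_isDiag s(a.1, a.2) (Sym2.mk_isDiag_iff.2 h)
  rw [hΓ, Set.ncard_eq_zero (Set.toFinite _)] at h0
  exact Set.eq_empty_iff_forall_notMem.1 h0 a ⟨ha, rfl⟩

/-- Double edges are oriented both ways, single edges upwards in an enumeration of `V`. -/
theorem exists_isUnderlying [Finite V] (T : UndirectedGraph V) :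
    ∃ Γ : Digraph V, IsUnderlying Γ T := by
  classical
  obtain ⟨n, ⟨ν⟩⟩ := Finite.exists_equiv_fin V
  let Γ : Digraph V := ⟨fun u v => T.mult s(u, v) = 2 ∨ T.mult s(u, v) = 1 ∧ ν u < ν v⟩
  refine ⟨Γ, fun e => ?_⟩
  induction e using Sym2.ind with
  | _ u v =>
  by_cases huv : u = v
  · subst huv
    have h0 := T.mult_of_isDiag s(u, u) (Sym2.mk_isDiag_iff.2 rfl)
    rw [h0, eq_comm, Set.ncard_eq_zero (Set.toFinite _), Set.eq_empty_iff_forall_notMem]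
    rintro ⟨a, b⟩ ⟨ha, hab⟩
    simp only at hab
    simp [arcs, Γ, hab, h0] at ha
  · rw [ncard_arcs_over Γ huv]
    have hν : ν u ≠ ν v := ν.injective.ne huv
    have h2 := T.mult_le_two s(u, v)
    have hm : T.mult s(u, v) = 0 ∨ T.mult s(u, v) = 1 ∨ T.mult s(u, v) = 2 := by omega
    simp only [Γ, Sym2.eq_swap (a := v) (b := u)]
    rcases hν.lt_or_gt with h | h <;> rcases hm with hm | hm | hm <;> simp [hm, h, h.not_gt]

end Underlying

/-! ### Rigidity of undirected pseudorange graphs -/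

section Decomposition

variable {V : Type*} [Fintype V] {d : ℕ} {T : UndirectedGraph V}

omit [Fintype V] in
/-- Every edge of a part of a decomposition can be oriented along an arc, in a prescribed direction
if it is a double edge. -/
theorem exists_arc_of_adj {Γ : Digraph V} (hΓ : IsUnderlying Γ T) {G : SimpleGraph V}
    (hG : G.edgeSet ⊆ {e | T.mult e = 1} ∪ {e | T.mult e = 2}) {r : V → V → Prop}
    (hr : ∀ u v, u ≠ v → r u v ∨ r v u) {u v : V} (h : G.Adj u v) :
    (u, v) ∈ {a ∈ arcs Γ | G.Adj a.1 a.2 ∧ (T.mult s(a.1, a.2) = 2 → r a.1 a.2)} ∨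
      (v, u) ∈ {a ∈ arcs Γ | G.Adj a.1 a.2 ∧ (T.mult s(a.1, a.2) = 2 → r a.1 a.2)} := by
  have hne := h.ne
  have hm : T.mult s(u, v) = 1 ∨ T.mult s(u, v) = 2 := hG h
  have h2 := hΓ.mult_eq_two_iff hne
  have h12 := hΓ.mult_eq_one_or_two_iff hne
  have h' := h.symm
  have hr' := hr u v hne
  have hs : s(v, u) = s(u, v) := Sym2.eq_swap
  simp only [arcs, Set.mem_ofPred_eq, hs]
  tauto

/-- A distance basis and an incidence basis on disjoint sets of arcs give an independent set of
pseudorange rows. A row outside the span of `arcs Γ` would enlarge it, but splitting the enlarged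
set bounds its size by the sum of the two ranks. -/
theorem isRigid_of_isDecomposition (hd : 2 ≤ d) {GD GS : SimpleGraph V}
    (hdec : IsDecomposition T GD GS) (hGD : IsDistanceRigid d GD) (hGS : GS.Connected) :
    IsRigid d T := by
  intro Γ hΓ p hp
  obtain ⟨n, ⟨ν⟩⟩ := Finite.exists_equiv_fin V
  have hν : ∀ u v, u ≠ v → ν u < ν v ∨ ν v < ν u := fun u v h => (ν.injective.ne h).lt_or_gt
  rw [isRigidFramework_pseudorangeConstraint_iff hd hp fun a ha => hΓ.ne ha]
  intro b hb
  by_contra hn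
  -- A double edge contributes its upward arc to `AD` and its downward arc to `AS`, which makes the
  -- two sets disjoint.
  set AD := {a ∈ arcs Γ | GD.Adj a.1 a.2 ∧ (T.mult s(a.1, a.2) = 2 → ν a.1 < ν a.2)} with hAD
  set AS := {a ∈ arcs Γ | GS.Adj a.1 a.2 ∧ (T.mult s(a.1, a.2) = 2 → ν a.2 < ν a.1)} with hAS
  obtain ⟨I, hIA, -, hIspan, hI⟩ := exists_linearIndepOn_extension
    (linearIndepOn_empty ℝ (distanceVec (coords p.1))) (Set.empty_subset AD)
  obtain ⟨J, hJA, -, hJspan, hJ⟩ := exists_linearIndepOn_extension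
    (linearIndepOn_empty ℝ (incidenceVec (V := V) ℝ)) (Set.empty_subset AS)
  have hD : ∀ a : V × V, a.1 ≠ a.2 →
      distanceVec (coords p.1) a ∈ Submodule.span ℝ (distanceVec (coords p.1) '' I) := by
    intro a ha
    have h1 := (isRigidFramework_distanceConstraint_iff (by omega) hp
      (E := {a : V × V | GD.Adj a.1 a.2}) (fun a h => SimpleGraph.Adj.ne h)).1 (hGD p.1 hp) a ha
    refine Submodule.span_le.2 ?_ h1
    rintro _ ⟨c, hc, rfl⟩
    rcases exists_arc_of_adj hΓ (hdec.1 ▸ Set.subset_union_left) hν hc with h | h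
    · exact hIspan ⟨_, h, rfl⟩
    · exact hIspan ⟨_, h, distanceVec_swap _ c⟩
  have hS : ∀ a : V × V,
      incidenceVec ℝ a ∈ Submodule.span ℝ (incidenceVec ℝ '' J) := by
    intro a
    have hle : GS ≤ arcGraph AS := by
      intro u v huv
      simp only [arcGraph, SimpleGraph.fromRel_adj]
      exact ⟨huv.ne, exists_arc_of_adj hΓ (hdec.1 ▸ Set.subset_union_right)
        (r := fun u v => ν v < ν u) (fun u v h => hν v u h.symm) huv⟩
    have h1 : incidenceVec ℝ a ∈ Submodule.span ℝ (incidenceVec ℝ '' AS) :=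
      single_sub_single_mem_span ((hGS.preconnected a.1 a.2).mono hle)
    exact Submodule.span_le.2 hJspan h1
  have hdisj : Disjoint I J := by
    rw [Set.disjoint_left]
    intro a haI haJ
    have h1 := hIA haI
    have h2 := hJA haJ
    have hm : T.mult s(a.1, a.2) = 2 := hdec.2.subset ⟨h1.2.1, h2.2.1⟩
    exact lt_asymm (h1.2.2 hm) (h2.2.2 hm)
  have hIJ : I ∪ J ⊆ arcs Γ :=
    Set.union_subset (fun a ha => (hIA ha).1) (fun a ha => (hJA ha).1)
  have hnIJ := fun h => hn (Submodule.span_mono (Set.image_mono hIJ) h)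
  have hbIJ : b ∉ I ∪ J := fun h => hnIJ (Submodule.subset_span ⟨b, h, rfl⟩)
  obtain ⟨K, hKsub, hK, hL⟩ := exists_split_of_linearIndepOn_pseudorangeVec
    ((linearIndepOn_insert hbIJ).2 ⟨linearIndepOn_pseudorangeVec_union hd hp hI hJ, hnIJ⟩)
  have h1 : K.ncard ≤ I.ncard := ncard_le_of_forall_mem_span hK fun a ha => hD a (by
    rcases hKsub ha with rfl | h
    · exact hb
    · exact hΓ.ne (hIJ h))
  have h2 := ncard_le_of_forall_mem_span hL fun a _ => hS a
  have h3 := Set.ncard_sdiff_add_ncard_of_subset hKsub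
  rw [Set.ncard_insert_of_notMem hbIJ, Set.ncard_union_eq hdisj] at h3
  omega

/-- Rigidity makes a basis of the rows of `Γ` as large as the sum of the full distance and incidence
ranks, so both parts of its splitting must have full rank. -/
theorem exists_isDecomposition_of_isRigid [Nonempty V] (hd : 2 ≤ d) (hT : IsRigid d T) :
    ∃ GD GS : SimpleGraph V, IsDecomposition T GD GS ∧ IsDistanceRigid d GD ∧ GS.Connected := by
  obtain ⟨Γ, hΓ⟩ := exists_isUnderlying T
  obtain ⟨x, hx⟩ := exists_genericPositions V d
  obtain ⟨n, ⟨ν⟩⟩ := Finite.exists_equiv_fin V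
  have hν : ∀ u v, u ≠ v → ν u < ν v ∨ ν v < ν u := fun u v h => (ν.injective.ne h).lt_or_gt
  have hrig := (isRigidFramework_pseudorangeConstraint_iff (p := (x, 0)) hd hx
    fun a ha => hΓ.ne ha).1 (hT Γ hΓ (x, 0) hx)
  -- Upward pairs suffice to span all distance rows and downward pairs all incidence rows, so bases
  -- `KK` and `LL` can be chosen disjoint.
  obtain ⟨KK, hKK, -, hKKspan, hKKind⟩ := exists_linearIndepOn_extension
    (linearIndepOn_empty ℝ (distanceVec (coords x)))
    (Set.empty_subset {a : V × V | ν a.1 < ν a.2})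
  obtain ⟨LL, hLL, -, hLLspan, hLLind⟩ := exists_linearIndepOn_extension
    (linearIndepOn_empty ℝ (incidenceVec (V := V) ℝ))
    (Set.empty_subset {a : V × V | ν a.2 < ν a.1})
  have hDall : ∀ a : V × V, a.1 ≠ a.2 →
      distanceVec (coords x) a ∈ Submodule.span ℝ (distanceVec (coords x) '' KK) := by
    intro a ha
    rcases hν _ _ ha with h | h
    · exact hKKspan ⟨a, h, rfl⟩
    · exact hKKspan ⟨a.swap, h, distanceVec_swap _ _⟩
  have hSall : ∀ a : V × V, a.1 ≠ a.2 →
      incidenceVec ℝ a ∈ Submodule.span ℝ (incidenceVec ℝ '' LL) := by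
    intro a ha
    rcases hν _ _ ha with h | h
    · rw [← a.swap_swap, incidenceVec_swap]
      exact Submodule.neg_mem _ (hLLspan ⟨a.swap, h, rfl⟩)
    · exact hLLspan ⟨a, h, rfl⟩
  obtain ⟨I, hIA, -, hIspan, hI⟩ := exists_linearIndepOn_extension
    (linearIndepOn_empty ℝ (pseudorangeVec (coords x) (edgeDist x)))
    (Set.empty_subset (arcs Γ))
  have hle : (KK ∪ LL).ncard ≤ I.ncard :=
    ncard_le_of_forall_mem_span (linearIndepOn_pseudorangeVec_union hd hx hKKind hLLind)
      fun a ha => Submodule.span_le.2 hIspan (hrig a (by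
        rcases ha with ha | ha
        · intro h
          have := hKK ha
          simp [h] at this
        · intro h
          have := hLL ha
          simp [h] at this))
  have hdisj : Disjoint KK LL := by
    rw [Set.disjoint_left]
    intro a h1 h2
    have h1 : ν a.1 < ν a.2 := hKK h1
    exact lt_asymm h1 (hLL h2)
  rw [Set.ncard_union_eq hdisj] at hle
  obtain ⟨K, hKI, hK, hL⟩ := exists_split_of_linearIndepOn_pseudorangeVec hI
  have hKne : ∀ a ∈ K, a.1 ≠ a.2 := fun a ha => hΓ.ne (hIA (hKI ha))
  have hLne : ∀ a ∈ I \ K, a.1 ≠ a.2 := fun a ha => hΓ.ne (hIA ha.1)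
  -- Together with `hle`, these bounds force `K` and `I \ K` to have the sizes of `KK` and `LL`.
  have h1 := ncard_le_of_forall_mem_span hK fun a ha => hDall a (hKne a ha)
  have h2 := ncard_le_of_forall_mem_span hL fun a ha => hSall a (hLne a ha)
  have h3 := Set.ncard_sdiff_add_ncard_of_subset hKI
  have hDK : ∀ b : V × V, b.1 ≠ b.2 →
      distanceVec (coords x) b ∈ Submodule.span ℝ (distanceVec (coords x) '' K) := by
    intro b hb
    by_contra hn
    have hbK : b ∉ K := fun h => hn (Submodule.subset_span ⟨b, h, rfl⟩)
    have h4 := ncard_le_of_forall_mem_span ((linearIndepOn_insert hbK).2 ⟨hK, hn⟩)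
      (I := KK) fun a ha => hDall a (by
        rcases ha with rfl | ha
        · exact hb
        · exact hKne a ha)
    rw [Set.ncard_insert_of_notMem hbK] at h4
    omega
  have hSL : ∀ b : V × V, b.1 ≠ b.2 →
      incidenceVec ℝ b ∈ Submodule.span ℝ (incidenceVec ℝ '' (I \ K)) := by
    intro b hb
    by_contra hn
    have hbL : b ∉ I \ K := fun h => hn (Submodule.subset_span ⟨b, h, rfl⟩)
    have h4 := ncard_le_of_forall_mem_span ((linearIndepOn_insert hbL).2 ⟨hL, hn⟩)
      (I := LL) fun a ha => hSall a (by
        rcases ha with rfl | ha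
        · exact hb
        · exact hLne a ha)
    rw [Set.ncard_insert_of_notMem hbL] at h4
    omega
  have hmult : ∀ a ∈ arcs Γ, T.mult s(a.1, a.2) = 1 ∨ T.mult s(a.1, a.2) = 2 := fun a ha =>
    (hΓ.mult_eq_one_or_two_iff (hΓ.ne ha)).2 (Or.inl ha)
  -- Double edges go to both graphs; a single edge goes to the distance graph if `K` uses it, and
  -- otherwise to the other one, even if it is not in `I`.
  let ED : Set (Sym2 V) := {e | T.mult e = 2 ∨ ∃ a ∈ K, s(a.1, a.2) = e}
  let ES : Set (Sym2 V) := {e | T.mult e = 2 ∨ T.mult e = 1 ∧ ¬ ∃ a ∈ K, s(a.1, a.2) = e}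
  have hED12 : ∀ e ∈ ED, T.mult e = 1 ∨ T.mult e = 2 := by
    rintro e (h | ⟨a, ha, rfl⟩)
    · exact Or.inr h
    · exact hmult a (hIA (hKI ha))
  have hES12 : ∀ e ∈ ES, T.mult e = 1 ∨ T.mult e = 2 := by
    rintro e (h | ⟨h, -⟩)
    · exact Or.inr h
    · exact Or.inl h
  have hedge : ∀ E : Set (Sym2 V), (∀ e ∈ E, T.mult e = 1 ∨ T.mult e = 2) →
      (SimpleGraph.fromEdgeSet E).edgeSet = E := by
    intro E hE
    rw [SimpleGraph.edgeSet_fromEdgeSet, sdiff_eq_left, Set.disjoint_left]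
    intro e he hdiag
    have h0 := T.mult_of_isDiag e (by simpa using hdiag)
    have := hE e he
    omega
  refine ⟨SimpleGraph.fromEdgeSet ED, SimpleGraph.fromEdgeSet ES, ⟨?_, ?_⟩, ?_, ?_⟩
  · rw [hedge ED hED12, hedge ES hES12]
    ext e
    have hD := hED12 e
    have hS := hES12 e
    simp only [Set.mem_union, Set.mem_ofPred_eq]
    simp only [ED, ES, Set.mem_ofPred_eq] at hD hS ⊢
    generalize (∃ a ∈ K, s(a.1, a.2) = e) = P at hD hS ⊢
    tauto
  · rw [hedge ED hED12, hedge ES hES12]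
    ext e
    simp only [ED, ES, Set.mem_inter_iff, Set.mem_ofPred_eq]
    generalize (∃ a ∈ K, s(a.1, a.2) = e) = P
    have h12 : T.mult e = 2 → T.mult e ≠ 1 := by omega
    tauto
  · intro y hy
    refine (isRigidFramework_distanceConstraint_iff (by omega) hy
      (E := {a : V × V | (SimpleGraph.fromEdgeSet ED).Adj a.1 a.2})
      fun a (h : (SimpleGraph.fromEdgeSet ED).Adj a.1 a.2) => h.ne).2 ?_
    intro b hb
    -- Independence passes both ways between the generic points `x` and `y`, so `K` still spans at
    -- `y`.
    have hKy := linearIndepOn_distanceVec_of_generic hy hK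
    have hbK : distanceVec (coords y) b ∈ Submodule.span ℝ (distanceVec (coords y) '' K) := by
      by_contra hn
      have hbK : b ∉ K := fun h => hn (Submodule.subset_span ⟨b, h, rfl⟩)
      have := linearIndepOn_distanceVec_of_generic hx ((linearIndepOn_insert hbK).2 ⟨hKy, hn⟩)
      exact ((linearIndepOn_insert hbK).1 this).2 (hDK b hb)
    refine Submodule.span_mono (Set.image_mono ?_) hbK
    intro a ha
    rw [Set.mem_ofPred_eq, SimpleGraph.fromEdgeSet_adj]
    exact ⟨Or.inr ⟨a, ha, rfl⟩, hKne a ha⟩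
  · rw [SimpleGraph.connected_iff]
    refine ⟨fun u v => ?_, inferInstance⟩
    by_cases huv : u = v
    · subst huv
      exact SimpleGraph.Reachable.refl _
    refine (reachable_of_mem_span hL (hSL (u, v) huv)).mono ?_
    have hin : ∀ a b : V, (a, b) ∈ I \ K → s(a, b) ∈ ES := by
      intro a b hab
      have hab' : (a, b) ∈ arcs Γ := hIA hab.1
      have hne : a ≠ b := hΓ.ne hab'
      by_cases h2 : T.mult s(a, b) = 2
      · exact Or.inl h2
      refine Or.inr ⟨(hmult _ hab').resolve_right h2, ?_⟩
      -- An arc of `K` over the same edge is either `(a, b)` itself, excluded by `I \ K`, or its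
      -- opposite, which would make the edge double.
      rintro ⟨⟨a', b'⟩, hK', h⟩
      rcases Sym2.eq_iff.1 h with ⟨h3, h4⟩ | ⟨h3, h4⟩
      · simp only at h3 h4
        subst h3 h4
        exact hab.2 hK'
      · simp only at h3 h4
        subst h3 h4
        exact h2 ((hΓ.mult_eq_two_iff hne).2 ⟨hab', hIA (hKI hK')⟩)
    intro a b hab
    simp only [arcGraph, SimpleGraph.fromRel_adj] at hab
    rw [SimpleGraph.fromEdgeSet_adj]
    refine ⟨?_, hab.1⟩
    rcases hab.2 with h | h
    · exact hin a b h
    · rw [Sym2.eq_swap]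
      exact hin b a h

end Decomposition

end Pseudorange

theorem corollary2 {V : Type*} [Fintype V] [Nonempty V] {d : ℕ} (hd : 2 ≤ d)
    (T : Pseudorange.UndirectedGraph V) :
    (Pseudorange.IsRigid d T ↔
      ∃ GD GS : SimpleGraph V, Pseudorange.IsDecomposition T GD GS ∧
        Pseudorange.IsDistanceRigid d GD ∧ GS.Connected) ∧
    ∀ Γ : Digraph V, Pseudorange.IsUnderlying Γ T →
      ∀ (p : Pseudorange.Config V d) (x : Pseudorange.Positions V d),
        Pseudorange.GenericConfig p → Pseudorange.GenericPositions x →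
        Pseudorange.IsMatroidUnion (Pseudorange.pseudorangeMatroid Γ p)
          (Pseudorange.distanceMatroid Γ x) (Pseudorange.cycleMatroid Γ) :=
  ⟨⟨Pseudorange.exists_isDecomposition_of_isRigid hd, fun ⟨_, _, hdec, hGD, hGS⟩ =>
    Pseudorange.isRigid_of_isDecomposition hd hdec hGD hGS⟩,
    fun Γ _ _ _ hp hx => Pseudorange.isMatroidUnion_pseudorangeMatroid hd Γ hp hx⟩
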